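/- Let $V$ be a finite set, let $\mathcal H_v$ ($v\in V$) be finite-dimensional complex Hilbert spaces, and put $\mathcal H_A=\bigotimes_{v\in A}\mathcal H_v$ for $A\subseteq V$, with $\mathcal H_\varnothing=\mathbb C$. For an operator $\rho$ on $\mathcal H_V$ let $\rho_A=\mathrm{Tr}_{V\setminus A}(\rho)$. For positive definite operators $X,Y$ put $S(X)=-\mathrm{Tr}(X\log X)$ and $$D(X\|Y)=\mathrm{Tr}(X\log X)-\mathrm{Tr}(X\log Y)-\mathrm{Tr}(X)+\mathrm{Tr}(Y).$$ Let $\mathcal G$ be a chordal graph on $V$ (every cycle of length at least four has a chord), and let $\mathcal C$ be the set of its cliques (inclusion-maximal complete vertex sets). A junction tree of $\mathcal G$ is a tree $\mathcal T$ with vertex set $\mathcal C$ such that every clique on the path in $\mathcal T$ between $C_1$ and $C_2$ contains $C_1\cap C_2$. Given a junction tree $\mathcal T$, let $\mathcal S=\{C_1\cap C_2: C_1\sim C_2\text{ in }\mathcal T\}$, and for $D\in\mathcal S$ let $\nu(D)$ be the number of edges $C_1\sim C_2$ of $\mathcal T$ with $C_1\cap C_2=D$. For $\rho$ positive definite with $\mathrm{Tr}(\rho)=1$,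 define $$gI(\mathcal G)_\rho=\sum_{C\in\mathcal C}S(\rho_C)-\sum_{D\in\mathcal S}\nu(D)S(\rho_D)-S(\rho),$$ $$T(\mathcal R_\rho)=\exp\Bigl\{\sum_{C\in\mathcal C}\log\rho_C-\sum_{D\in\mathcal S}\nu(D)\log\rho_D\Bigr\},$$ where an operator on $\mathcal H_A$ acts on $\mathcal H_V$ after tensoring with the identity of $\mathcal H_{V\setminus A}$. **Proposition.** The chordal graph $\mathcal G$ has a junction tree, and for every junction tree of $\mathcal G$ and every strictly positive density operator $\rho$ on $\mathcal H_V$, $$gI(\mathcal G)_\rho=D(\rho\|T(\mathcal R_\rho))+1-\mathrm{Tr}(T(\mathcal R_\rho)).$$ In particular, if $\mathrm{Tr}(T(\mathcal R_\rho))=1$ and $\rho^\star_{\mathcal G}=T(\mathcal R_\rho)$, then $$gI(\mathcal G)_\rho=D(\rho\|\rho^\star_{\mathcal G})=S(\rho^\star_{\mathcal G})-S(\rho).$$ -/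

import Mathlib

open scoped Kronecker ComplexOrder

noncomputable section

namespace QuantumGraph

universe u w

section Operators

/-- Labels of the product orthonormal basis of `H_A = ⨂_{v ∈ A} H_v`, where `H_v` has an orthonormal
basis labelled by `ι v`. For `A = ∅` there is exactly one label, so that `H_∅ = ℂ`. -/
abbrev Idx {V : Type u} (ι : V → Type w) (A : Finset V) : Type (max u w) :=
  (v : {v // v ∈ A}) → ι v

/-- Linear operators on `H_A`, as matrices in the product basis. -/
abbrev Op {V : Type u} (ι : V → Type w) (A : Finset V) : Type (max u w) :=
  Matrix (Idx ι A) (Idx ι A) ℂ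

/-- Linear operators on the total space `H_V = ⨂_{v ∈ V} H_v`, as matrices in the product basis. -/
abbrev GlobalOp {V : Type u} (ι : V → Type w) : Type (max u w) :=
  Matrix ((v : V) → ι v) ((v : V) → ι v) ℂ

/-- Strictly positive density operators. -/
def IsStrictDensity {n : Type w} [Fintype n] (ρ : Matrix n n ℂ) : Prop :=
  ρ.PosDef ∧ ρ.trace = 1

/-- The splitting `H_V ≅ H_A ⊗ H_{V ∖ A}` on basis labels. -/
def splitIdx {V : Type u} [DecidableEq V] (ι : V → Type w) (A : Finset V) :
    ((v : V) → ι v) ≃ Idx ι A × ((v : {v // v ∉ A}) → ι v) :=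
  Equiv.piEquivPiSubtypeProd (fun v => v ∈ A) ι

/-- The reduced operator `ρ_A = Tr_{V ∖ A} ρ`. -/
def reduced {V : Type u} [Fintype V] [DecidableEq V] {ι : V → Type w} [∀ v, Fintype (ι v)]
    (ρ : GlobalOp ι) (A : Finset V) : Op ι A :=
  fun i j => ∑ k : ((v : {v // v ∉ A}) → ι v),
    ρ ((splitIdx ι A).symm (i, k)) ((splitIdx ι A).symm (j, k))

/-- The operator `M ⊗ I_{V ∖ A}` on `H_V`, for an operator `M` on `H_A`. -/
def extend {V : Type u} [DecidableEq V] {ι : V → Type w} [∀ v, DecidableEq (ι v)] [Fintype V]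
    (A : Finset V) (M : Op ι A) : GlobalOp ι :=
  (M ⊗ₖ (1 : Matrix ((v : {v // v ∉ A}) → ι v) ((v : {v // v ∉ A}) → ι v) ℂ)).submatrix
    (splitIdx ι A) (splitIdx ι A)

/-- The logarithm of a positive definite matrix, through the functional calculus. -/
def matLog {n : Type w} [Fintype n] [DecidableEq n] (X : Matrix n n ℂ) : Matrix n n ℂ :=
  cfc Real.log X

/-- The von Neumann entropy `S(X) = -Tr(X log X)`. The trace is a real number; `re` only moves it
from `ℂ` to `ℝ`. -/
def entropy {n : Type w} [Fintype n] [DecidableEq n] (X : Matrix n n ℂ) : ℝ :=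
  -(X * matLog X).trace.re

/-- The von Neumann divergence
`D(X‖Y) = Tr(X log X) - Tr(X log Y) - Tr X + Tr Y` of positive definite matrices. All four traces
are real numbers. -/
def divergence {n : Type w} [Fintype n] [DecidableEq n] (X Y : Matrix n n ℂ) : ℝ :=
  (X * matLog X).trace.re - (X * matLog Y).trace.re - X.trace.re + Y.trace.re

end Operators

section Graphs

/-- Every cycle of length at least four has a chord: an edge of the graph that joins two vertices
of the cycle which are not consecutive on it. -/
def IsChordal {V : Type u} (G : SimpleGraph V) : Prop :=
  ∀ (v : V) (p : G.Walk v v), p.IsCycle → 4 ≤ p.length →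
    ∃ a ∈ p.support, ∃ b ∈ p.support, G.Adj a b ∧ s(a, b) ∉ p.edges

/-- The cliques of `G`: the inclusion-maximal complete vertex sets. -/
abbrev MaxClique {V : Type u} (G : SimpleGraph V) : Type u :=
  {C : Finset V // Maximal (fun s : Finset V => G.IsClique (s : Set V)) C}

instance {V : Type u} [Fintype V] (G : SimpleGraph V) : Fintype (MaxClique G) :=
  Fintype.ofFinite _

/-- A junction tree of `G`: a tree on the cliques of `G` such that every clique on the path between
`C₁` and `C₂` contains `C₁ ∩ C₂`. -/
def IsJunctionTree {V : Type u} [DecidableEq V] (G : SimpleGraph V)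
    (J : SimpleGraph (MaxClique G)) : Prop :=
  J.IsTree ∧ ∀ (C₁ C₂ : MaxClique G) (p : J.Walk C₁ C₂), p.IsPath →
    ∀ C ∈ p.support, C₁.1 ∩ C₂.1 ⊆ C.1

/-- The intersection `C₁ ∩ C₂` attached to an unordered pair of cliques. -/
def pairInter {V : Type u} [DecidableEq V] {G : SimpleGraph V} (e : Sym2 (MaxClique G)) :
    Finset V :=
  Sym2.lift ⟨fun C₁ C₂ => C₁.1 ∩ C₂.1, fun C₁ C₂ => Finset.inter_comm C₁.1 C₂.1⟩ e

open Classical in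
/-- The edges of `J`, as a finite set of unordered pairs of cliques. -/
def treeEdges {V : Type u} [Fintype V] {G : SimpleGraph V} (J : SimpleGraph (MaxClique G)) :
    Finset (Sym2 (MaxClique G)) :=
  Finset.univ.filter (fun e => e ∈ J.edgeSet)

/-- The set of separators read off from the junction tree `J`. -/
def separators {V : Type u} [Fintype V] [DecidableEq V] {G : SimpleGraph V}
    (J : SimpleGraph (MaxClique G)) : Finset (Finset V) :=
  (treeEdges J).image pairInter

/-- The multiplicity `ν(D)`: the number of edges of the junction tree whose intersection is `D`. -/
def multiplicity {V : Type u} [Fintype V] [DecidableEq V] {G : SimpleGraph V}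
    (J : SimpleGraph (MaxClique G)) (D : Finset V) : ℕ :=
  ((treeEdges J).filter (fun e => pairInter e = D)).card

end Graphs

section Main

/-- The global information
`gI(G)_ρ = ∑_C S(ρ_C) - ∑_D ν(D) S(ρ_D) - S(ρ)`, with the separators and multiplicities read off
from the junction tree `J` of `G`. -/
def globalInformation {V : Type u} [Fintype V] [DecidableEq V] {ι : V → Type w}
    [∀ v, Fintype (ι v)] [∀ v, DecidableEq (ι v)] {G : SimpleGraph V}
    (J : SimpleGraph (MaxClique G)) (ρ : GlobalOp ι) : ℝ :=
  (∑ C : MaxClique G, entropy (reduced ρ C.1))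
    - (∑ D ∈ separators J, (multiplicity J D : ℝ) * entropy (reduced ρ D))
    - entropy ρ

/-- The logarithmic candidate
`T(R_ρ) = exp(∑_C log ρ_C - ∑_D ν(D) log ρ_D)` built from the clique marginals of `ρ`, where
operators on `H_A` act on `H_V` as `· ⊗ I_{V ∖ A}`. -/
def logCandidate {V : Type u} [Fintype V] [DecidableEq V] {ι : V → Type w}
    [∀ v, Fintype (ι v)] [∀ v, DecidableEq (ι v)] {G : SimpleGraph V}
    (J : SimpleGraph (MaxClique G)) (ρ : GlobalOp ι) : GlobalOp ι :=
  NormedSpace.exp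
    ((∑ C : MaxClique G, extend C.1 (matLog (reduced ρ C.1)))
      - ∑ D ∈ separators J, multiplicity J D • extend D (matLog (reduced ρ D)))

end Main

end QuantumGraph

end

namespace QuantumGraph

section Spectral

variable {n : Type*} [Fintype n] [DecidableEq n]

open Matrix

theorem trace_diagonal_mul_mul_diagonal_mul (a b : n → ℂ) (Z V : Matrix n n ℂ) :
    (diagonal a * Z * diagonal b * V).trace = ∑ i, ∑ j, a i * b j * (Z i j * V j i) := by
  refine Finset.sum_congr rfl fun i _ => ?_
  rw [diag_apply, mul_apply]
  refine Finset.sum_congr rfl fun j _ => ?_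
  rw [mul_diagonal, diagonal_mul]
  ring

/-- The matrix `U f(p) U*`. -/
noncomputable def spectralMatrix (U : unitaryGroup n ℂ) (p : n → ℝ) : Matrix n n ℂ :=
  (U : Matrix n n ℂ) * diagonal (fun i => (p i : ℂ)) * star (U : Matrix n n ℂ)

/-- The squared overlaps of two orthonormal bases. -/
noncomputable def overlap (U W : unitaryGroup n ℂ) (i j : n) : ℝ :=
  Complex.normSq ((star (U : Matrix n n ℂ) * (W : Matrix n n ℂ)) i j)

theorem overlap_nonneg (U W : unitaryGroup n ℂ) (i j : n) : 0 ≤ overlap U W i j :=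
  Complex.normSq_nonneg _

theorem trace_spectralMatrix_mul (U W : unitaryGroup n ℂ) (p q : n → ℝ) :
    (spectralMatrix U p * spectralMatrix W q).trace.re
      = ∑ i, ∑ j, overlap U W i j * (p i * q j) := by
  have h : (spectralMatrix U p * spectralMatrix W q).trace
      = (diagonal (fun i => (p i : ℂ)) * (star (U : Matrix n n ℂ) * (W : Matrix n n ℂ))
        * diagonal (fun i => (q i : ℂ))
        * star (star (U : Matrix n n ℂ) * (W : Matrix n n ℂ))).trace := by
    unfold spectralMatrix
    rw [show (U : Matrix n n ℂ) * diagonal (fun i => (p i : ℂ)) * star (U : Matrix n n ℂ)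
        * ((W : Matrix n n ℂ) * diagonal (fun i => (q i : ℂ)) * star (W : Matrix n n ℂ))
        = (U : Matrix n n ℂ) * (diagonal (fun i => (p i : ℂ)) * star (U : Matrix n n ℂ)
        * ((W : Matrix n n ℂ) * diagonal (fun i => (q i : ℂ)) * star (W : Matrix n n ℂ))) by
          simp only [mul_assoc], trace_mul_comm]
    simp only [mul_assoc, star_mul, star_star]
  rw [h, trace_diagonal_mul_mul_diagonal_mul, Complex.re_sum]
  refine Finset.sum_congr rfl fun i _ => ?_
  rw [Complex.re_sum]
  refine Finset.sum_congr rfl fun j _ => ?_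
  rw [star_eq_conjTranspose (star _ * _), conjTranspose_apply, ← starRingEnd_apply, Complex.mul_conj]
  rw [show ((p i : ℂ) * (q j : ℂ)) = ((p i * q j : ℝ) : ℂ) by push_cast; ring]
  rw [← Complex.ofReal_mul, Complex.ofReal_re, overlap, mul_comm]

theorem spectralMatrix_one (U : unitaryGroup n ℂ) : spectralMatrix U (fun _ => 1) = 1 := by
  simp [spectralMatrix]

theorem trace_spectralMatrix_left (U W : unitaryGroup n ℂ) (p : n → ℝ) :
    (spectralMatrix U p).trace.re = ∑ i, ∑ j, overlap U W i j * p i := by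
  have := trace_spectralMatrix_mul U W p (fun _ => 1)
  rw [spectralMatrix_one, mul_one] at this
  simpa using this

theorem trace_spectralMatrix_right (U W : unitaryGroup n ℂ) (q : n → ℝ) :
    (spectralMatrix W q).trace.re = ∑ i, ∑ j, overlap U W i j * q j := by
  have := trace_spectralMatrix_mul U W (fun _ => 1) q
  rw [spectralMatrix_one, one_mul] at this
  simpa using this

theorem spectralMatrix_mul_self_apply (U : unitaryGroup n ℂ) (p q : n → ℝ) :
    spectralMatrix U p * spectralMatrix U q = spectralMatrix U (fun i => p i * q i) := by
  have hU : star (U : Matrix n n ℂ) * (U : Matrix n n ℂ) = 1 := by simp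
  unfold spectralMatrix
  calc _ = (U : Matrix n n ℂ) * diagonal (fun i => (p i : ℂ))
        * (star (U : Matrix n n ℂ) * (U : Matrix n n ℂ)) * diagonal (fun i => (q i : ℂ))
        * star (U : Matrix n n ℂ) := by simp only [mul_assoc]
    _ = _ := by
      rw [hU, mul_one, mul_assoc (U : Matrix n n ℂ), diagonal_mul_diagonal]
      simp

theorem IsHermitian.exists_spectralMatrix {X : Matrix n n ℂ} (hX : X.IsHermitian) :
    ∃ U : unitaryGroup n ℂ, X = spectralMatrix U hX.eigenvalues ∧
      ∀ f : ℝ → ℝ, cfc f X = spectralMatrix U (fun i => f (hX.eigenvalues i)) := by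
  refine ⟨hX.eigenvectorUnitary, ?_, fun f => ?_⟩
  · conv_lhs => rw [hX.spectral_theorem]
    rfl
  · rw [hX.cfc_eq]
    rfl

/-- Positive definite matrices in spectral form. -/
theorem PosDef.exists_spectralMatrix {X : Matrix n n ℂ} (hX : X.PosDef) :
    ∃ (U : unitaryGroup n ℂ) (p : n → ℝ), (∀ i, 0 < p i) ∧ X = spectralMatrix U p ∧
      matLog X = spectralMatrix U (fun i => Real.log (p i)) := by
  obtain ⟨U, h1, h2⟩ := IsHermitian.exists_spectralMatrix hX.1
  exact ⟨U, hX.1.eigenvalues, hX.eigenvalues_pos, h1, h2 _⟩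

theorem divergence_spectralMatrix {X Y : Matrix n n ℂ} {U W : unitaryGroup n ℂ} {p q : n → ℝ}
    (hX : X = spectralMatrix U p) (hY : Y = spectralMatrix W q)
    (hX' : matLog X = spectralMatrix U (fun i => Real.log (p i)))
    (hY' : matLog Y = spectralMatrix W (fun i => Real.log (q i))) :
    divergence X Y = ∑ i, ∑ j, overlap U W i j *
      (p i * Real.log (p i) - p i * Real.log (q j) - p i + q j) := by
  unfold divergence
  rw [hX', hY', hX, hY, spectralMatrix_mul_self_apply, trace_spectralMatrix_left U W,
    trace_spectralMatrix_left U W, trace_spectralMatrix_mul, trace_spectralMatrix_right U W]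
  simp only [← Finset.sum_sub_distrib, ← Finset.sum_add_distrib]
  exact Finset.sum_congr rfl fun i _ => Finset.sum_congr rfl fun j _ => by ring

theorem klein_term {p q : ℝ} (hp : 0 < p) (hq : 0 < q) :
    0 ≤ p * Real.log p - p * Real.log q - p + q := by
  have h := Real.log_le_sub_one_of_pos (div_pos hq hp)
  rw [Real.log_div hq.ne' hp.ne'] at h
  have h2 := mul_le_mul_of_nonneg_left h hp.le
  have h3 : p * (q / p - 1) = q - p := by field_simp
  nlinarith

theorem klein_term_eq {p q : ℝ} (hp : 0 < p) (hq : 0 < q)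
    (h0 : p * Real.log p - p * Real.log q - p + q = 0) : p = q := by
  by_contra hne
  have hne' : q / p ≠ 1 := fun h => hne (by rw [div_eq_one_iff_eq hp.ne'] at h; exact h.symm)
  have h := Real.log_lt_sub_one_of_pos (div_pos hq hp) hne'
  rw [Real.log_div hq.ne' hp.ne'] at h
  have h2 := mul_lt_mul_of_pos_left h hp
  have h3 : p * (q / p - 1) = q - p := by field_simp
  nlinarith

/-- Klein's inequality. -/
theorem divergence_nonneg {X Y : Matrix n n ℂ} (hX : X.PosDef) (hY : Y.PosDef) :
    0 ≤ divergence X Y := by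
  obtain ⟨U, p, hp, h1, h2⟩ := PosDef.exists_spectralMatrix hX
  obtain ⟨W, q, hq, h3, h4⟩ := PosDef.exists_spectralMatrix hY
  rw [divergence_spectralMatrix h1 h3 h2 h4]
  exact Finset.sum_nonneg fun i _ => Finset.sum_nonneg fun j _ =>
    mul_nonneg (overlap_nonneg ..) (klein_term (hp i) (hq j))

/-- The equality case of Klein's inequality. -/
theorem eq_of_divergence_eq_zero {X Y : Matrix n n ℂ} (hX : X.PosDef) (hY : Y.PosDef)
    (h : divergence X Y = 0) : X = Y := by
  obtain ⟨U, p, hp, h1, h2⟩ := PosDef.exists_spectralMatrix hX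
  obtain ⟨W, q, hq, h3, h4⟩ := PosDef.exists_spectralMatrix hY
  rw [divergence_spectralMatrix h1 h3 h2 h4] at h
  have hnn : ∀ i j, 0 ≤ overlap U W i j *
      (p i * Real.log (p i) - p i * Real.log (q j) - p i + q j) := fun i j =>
    mul_nonneg (overlap_nonneg ..) (klein_term (hp i) (hq j))
  have hz : ∀ i j, overlap U W i j = 0 ∨ p i = q j := by
    intro i j
    have h5 := (Finset.sum_eq_zero_iff_of_nonneg
      (fun i _ => Finset.sum_nonneg fun j _ => hnn i j)).1 h i (Finset.mem_univ _)
    have h6 := (Finset.sum_eq_zero_iff_of_nonneg (fun j _ => hnn i j)).1 h5 j (Finset.mem_univ _)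
    exact (mul_eq_zero.1 h6).imp id (klein_term_eq (hp i) (hq j))
  have hUU : (U : Matrix n n ℂ) * star (U : Matrix n n ℂ) = 1 := by simp
  have hWW : (W : Matrix n n ℂ) * star (W : Matrix n n ℂ) = 1 := by simp
  have hcomm : diagonal (fun i => (p i : ℂ)) * (star (U : Matrix n n ℂ) * (W : Matrix n n ℂ))
      = (star (U : Matrix n n ℂ) * (W : Matrix n n ℂ)) * diagonal (fun i => (q i : ℂ)) := by
    ext i j
    rw [diagonal_mul, mul_diagonal]
    rcases hz i j with h0 | h0
    · rw [Complex.normSq_eq_zero.1 h0]; simp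
    · rw [h0, mul_comm]
  rw [h1, h3]
  unfold spectralMatrix
  calc (U : Matrix n n ℂ) * diagonal (fun i => (p i : ℂ)) * star (U : Matrix n n ℂ)
      = (U : Matrix n n ℂ) * (diagonal (fun i => (p i : ℂ))
        * (star (U : Matrix n n ℂ) * (W : Matrix n n ℂ))) * star (W : Matrix n n ℂ) := by
        rw [mul_assoc (U : Matrix n n ℂ), mul_assoc (U : Matrix n n ℂ), mul_assoc (diagonal _),
          mul_assoc (star (U : Matrix n n ℂ)), hWW, mul_one]
    _ = ((U : Matrix n n ℂ) * star (U : Matrix n n ℂ)) * (W : Matrix n n ℂ)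
        * diagonal (fun i => (q i : ℂ)) * star (W : Matrix n n ℂ) := by
        rw [hcomm]; simp only [mul_assoc]
    _ = _ := by rw [hUU, one_mul]

end Spectral

section DataProcessing

open Matrix Filter Topology

variable {n m : Type*} [Fintype n] [DecidableEq n] [Fintype m] [DecidableEq m]

/-- The quadratic functional whose supremum over `Z` is `resolventForm`. -/
noncomputable def resolventTest (X Y : Matrix n n ℂ) (t : ℝ) (Z : Matrix n n ℂ) : ℝ :=
  2 * (X * Z).trace.re - (Y * (star Z * Z)).trace.re - t * (X * (Z * star Z)).trace.re

/-- The form `∑ |⟨i|j⟩|² p_i² / (q_j + t p_i)`. -/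
noncomputable def resolventForm (U W : unitaryGroup n ℂ) (p q : n → ℝ) (t : ℝ) : ℝ :=
  ∑ i, ∑ j, overlap U W i j * (p i ^ 2 / (q j + t * p i))

theorem resolventTest_eq (U W : unitaryGroup n ℂ) (p q : n → ℝ) (t : ℝ) (K : Matrix n n ℂ) :
    resolventTest (spectralMatrix U p) (spectralMatrix W q) t
        ((U : Matrix n n ℂ) * K * star (W : Matrix n n ℂ))
      = ∑ i, ∑ j, (2 * p i
          * (K i j * star ((star (U : Matrix n n ℂ) * (W : Matrix n n ℂ)) i j)).re
          - (q j + t * p i) * Complex.normSq (K i j)) := by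
  have hUU : star (U : Matrix n n ℂ) * (U : Matrix n n ℂ) = 1 := by simp
  have hWW : star (W : Matrix n n ℂ) * (W : Matrix n n ℂ) = 1 := by simp
  set u : Matrix n n ℂ := (U : Matrix n n ℂ)
  set w : Matrix n n ℂ := (W : Matrix n n ℂ)
  set a : n → ℂ := fun i => (p i : ℂ) with ha
  set b : n → ℂ := fun i => (q i : ℂ) with hb
  have e1 : (u * diagonal a * star u * (u * K * star w)).trace
      = (diagonal a * K * diagonal 1 * star (star u * w)).trace := by
    calc _ = (u * (diagonal a * (star u * u) * K * star w)).trace := by simp only [mul_assoc]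
      _ = _ := by
        rw [hUU, trace_mul_comm]
        simp [mul_assoc]
  have e2 : (w * diagonal b * star w * (star (u * K * star w) * (u * K * star w))).trace
      = (diagonal 1 * K * diagonal b * star K).trace := by
    calc _ = (w * (diagonal b * (star w * w) * star K * (star u * u) * K * star w)).trace := by
            simp only [mul_assoc, star_mul, star_star]
      _ = _ := by
        rw [hUU, hWW, trace_mul_comm]
        simp only [mul_one, mul_assoc, hWW]
        rw [← mul_assoc, trace_mul_comm]
        simp
  have e3 : (u * diagonal a * star u * ((u * K * star w) * star (u * K * star w))).trace
      = (diagonal a * K * diagonal 1 * star K).trace := by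
    calc _ = (u * (diagonal a * (star u * u) * K * (star w * w) * star K * star u)).trace := by
            simp only [mul_assoc, star_mul, star_star]
      _ = _ := by
        rw [hUU, hWW, trace_mul_comm]
        simp only [mul_one, mul_assoc, hUU]
        simp
  have hs : ∀ (M : Matrix n n ℂ) i j, (star M) j i = star (M i j) := fun M i j => rfl
  have hn : ∀ z : ℂ, z * star z = ((Complex.normSq z : ℝ) : ℂ) := fun z => by
    rw [← starRingEnd_apply, Complex.mul_conj]
  unfold resolventTest spectralMatrix
  rw [e1, e2, e3]
  simp only [trace_diagonal_mul_mul_diagonal_mul, hs, hn, Pi.one_apply, mul_one, one_mul,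
    Complex.re_sum, ha, hb, Complex.re_ofReal_mul, Complex.ofReal_re, Finset.mul_sum,
    ← Finset.sum_sub_distrib]
  exact Finset.sum_congr rfl fun i _ => Finset.sum_congr rfl fun j _ => by ring

theorem two_mul_re_sub_le (z v : ℂ) {p s : ℝ} (hs : 0 < s) :
    2 * p * (z * star v).re - s * Complex.normSq z ≤ Complex.normSq v * (p ^ 2 / s) := by
  have h := Complex.normSq_nonneg ((s : ℂ) * z - p * v)
  have h2 : Complex.normSq ((s : ℂ) * z - p * v)
      = s * (s * Complex.normSq z - 2 * p * (z * star v).re) + p ^ 2 * Complex.normSq v := by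
    simp only [Complex.normSq_apply, Complex.sub_re, Complex.sub_im, Complex.mul_re,
      Complex.mul_im, Complex.ofReal_re, Complex.ofReal_im, Complex.star_def, Complex.conj_re,
      Complex.conj_im]
    ring
  rw [h2] at h
  rw [← mul_div_assoc, le_div_iff₀ hs]
  linarith

theorem resolventTest_le (U W : unitaryGroup n ℂ) {p q : n → ℝ} {t : ℝ} (hp : ∀ i, 0 < p i)
    (hq : ∀ i, 0 < q i) (ht : 0 ≤ t) (Z : Matrix n n ℂ) :
    resolventTest (spectralMatrix U p) (spectralMatrix W q) t Z ≤ resolventForm U W p q t := by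
  have hUU : (U : Matrix n n ℂ) * star (U : Matrix n n ℂ) = 1 := by simp
  have hWW : (W : Matrix n n ℂ) * star (W : Matrix n n ℂ) = 1 := by simp
  have hZ : Z = (U : Matrix n n ℂ) * (star (U : Matrix n n ℂ) * Z * (W : Matrix n n ℂ))
      * star (W : Matrix n n ℂ) := by
    calc Z = ((U : Matrix n n ℂ) * star (U : Matrix n n ℂ)) * Z
          * ((W : Matrix n n ℂ) * star (W : Matrix n n ℂ)) := by rw [hUU, hWW, one_mul, mul_one]
      _ = _ := by simp only [mul_assoc]
  rw [hZ, resolventTest_eq]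
  exact Finset.sum_le_sum fun i _ => Finset.sum_le_sum fun j _ =>
    two_mul_re_sub_le _ _ (add_pos_of_pos_of_nonneg (hq j) (mul_nonneg ht (hp i).le))

theorem exists_resolventTest_eq (U W : unitaryGroup n ℂ) {p q : n → ℝ} {t : ℝ}
    (hp : ∀ i, 0 < p i) (hq : ∀ i, 0 < q i) (ht : 0 ≤ t) :
    ∃ Z, resolventTest (spectralMatrix U p) (spectralMatrix W q) t Z
      = resolventForm U W p q t := by
  refine ⟨(U : Matrix n n ℂ) * (Matrix.of fun i j => ((p i / (q j + t * p i) : ℝ) : ℂ)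
      * (star (U : Matrix n n ℂ) * (W : Matrix n n ℂ)) i j) * star (W : Matrix n n ℂ), ?_⟩
  rw [resolventTest_eq]
  refine Finset.sum_congr rfl fun i _ => Finset.sum_congr rfl fun j _ => ?_
  have hs : q j + t * p i ≠ 0 := (add_pos_of_pos_of_nonneg (hq j) (mul_nonneg ht (hp i).le)).ne'
  rw [of_apply, overlap]
  generalize (star (U : Matrix n n ℂ) * (W : Matrix n n ℂ)) i j = v
  rw [mul_assoc (Complex.ofReal _), ← starRingEnd_apply, Complex.mul_conj, ← Complex.ofReal_mul,
    Complex.ofReal_re, Complex.normSq_mul, Complex.normSq_ofReal]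
  field_simp
  ring

theorem resolventTest_map (ε : Matrix m m ℂ →⋆ₐ[ℂ] Matrix n n ℂ) {X Y : Matrix n n ℂ}
    {X' Y' : Matrix m m ℂ} (hX : ∀ M, (X' * M).trace = (X * ε M).trace)
    (hY : ∀ M, (Y' * M).trace = (Y * ε M).trace) (t : ℝ) (Z : Matrix m m ℂ) :
    resolventTest X' Y' t Z = resolventTest X Y t (ε Z) := by
  simp only [resolventTest, hX, hY, map_mul, map_star]

/-- The primitive of `resolventForm` in `t` that vanishes at `0`. -/
noncomputable def logForm (U W : unitaryGroup n ℂ) (p q : n → ℝ) (t : ℝ) : ℝ :=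
  ∑ i, ∑ j, overlap U W i j * (p i * (Real.log (q j + t * p i) - Real.log (q j)))

theorem hasDerivAt_logForm (U W : unitaryGroup n ℂ) {p q : n → ℝ} {t : ℝ}
    (hp : ∀ i, 0 < p i) (hq : ∀ i, 0 < q i) (ht : 0 ≤ t) :
    HasDerivAt (logForm U W p q) (resolventForm U W p q t) t := by
  unfold logForm resolventForm
  refine HasDerivAt.fun_sum fun i _ => HasDerivAt.fun_sum fun j _ => HasDerivAt.const_mul _ ?_
  have hs : q j + t * p i ≠ 0 := (add_pos_of_pos_of_nonneg (hq j) (mul_nonneg ht (hp i).le)).ne'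
  have h1 : HasDerivAt (fun x : ℝ => q j + x * p i) (p i) t := by
    simpa using ((hasDerivAt_id t).mul_const (p i)).const_add (q j)
  have h2 := ((h1.log hs).sub_const (Real.log (q j))).const_mul (p i)
  convert h2 using 1
  ring

theorem tendsto_log_add_mul_sub_log {p q : ℝ} (hp : 0 < p) :
    Tendsto (fun t : ℝ => Real.log (q + t * p) - Real.log t) atTop (𝓝 (Real.log p)) := by
  have h1 : Tendsto (fun t : ℝ => q / t + p) atTop (𝓝 p) := by
    simpa using (tendsto_const_nhds.div_atTop tendsto_id).add_const p
  refine (((Real.continuousAt_log hp.ne').tendsto.comp h1)).congr' ?_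
  have h2 : ∀ᶠ t : ℝ in atTop, 0 < q / t + p := h1.eventually (lt_mem_nhds hp)
  filter_upwards [h2, eventually_gt_atTop 0] with t ht ht0
  rw [Function.comp_apply, eq_sub_iff_add_eq, ← Real.log_mul ht.ne' ht0.ne']
  congr 1
  field_simp

theorem tendsto_logForm (U W : unitaryGroup n ℂ) {p q : n → ℝ} (hp : ∀ i, 0 < p i) :
    Tendsto (fun t => logForm U W p q t - (∑ i, ∑ j, overlap U W i j * p i) * Real.log t) atTop
      (𝓝 (∑ i, ∑ j, overlap U W i j * (p i * Real.log (p i) - p i * Real.log (q j)))) := by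
  have h : Tendsto (fun t => ∑ i, ∑ j, overlap U W i j
      * (p i * ((Real.log (q j + t * p i) - Real.log t) - Real.log (q j)))) atTop
      (𝓝 (∑ i, ∑ j, overlap U W i j * (p i * (Real.log (p i) - Real.log (q j))))) :=
    tendsto_finsetSum _ fun i _ => tendsto_finsetSum _ fun j _ =>
      (((tendsto_log_add_mul_sub_log (hp i)).sub_const _).const_mul _).const_mul _
  convert h using 2
  · simp only [logForm, Finset.sum_mul, ← Finset.sum_sub_distrib]
    exact Finset.sum_congr rfl fun i _ => Finset.sum_congr rfl fun j _ => by ring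
  · exact Finset.sum_congr rfl fun i _ => Finset.sum_congr rfl fun j _ => by ring

theorem divergence_eq_sub_add {X Y : Matrix n n ℂ} {U W : unitaryGroup n ℂ} {p q : n → ℝ}
    (hX : X = spectralMatrix U p) (hY : Y = spectralMatrix W q)
    (hX' : matLog X = spectralMatrix U (fun i => Real.log (p i)))
    (hY' : matLog Y = spectralMatrix W (fun i => Real.log (q i))) :
    divergence X Y =
      (∑ i, ∑ j, overlap U W i j * (p i * Real.log (p i) - p i * Real.log (q j)))
        - X.trace.re + Y.trace.re := by
  rw [divergence_spectralMatrix hX hY hX' hY', hX, hY, trace_spectralMatrix_left U W,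
    trace_spectralMatrix_right U W]
  simp only [← Finset.sum_sub_distrib, ← Finset.sum_add_distrib]
  exact Finset.sum_congr rfl fun i _ => Finset.sum_congr rfl fun j _ => by ring

/-- Monotonicity of the von Neumann divergence under restriction to a matrix subalgebra. -/
theorem divergence_le_of_trace_eq (ε : Matrix m m ℂ →⋆ₐ[ℂ] Matrix n n ℂ) {X Y : Matrix n n ℂ}
    {X' Y' : Matrix m m ℂ} (hXp : X.PosDef) (hYp : Y.PosDef) (hXp' : X'.PosDef)
    (hYp' : Y'.PosDef) (hX : ∀ M, (X' * M).trace = (X * ε M).trace)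
    (hY : ∀ M, (Y' * M).trace = (Y * ε M).trace) :
    divergence X' Y' ≤ divergence X Y := by
  obtain ⟨U, p, hp, h1, h2⟩ := PosDef.exists_spectralMatrix hXp
  obtain ⟨W, q, hq, h3, h4⟩ := PosDef.exists_spectralMatrix hYp
  obtain ⟨U', p', hp', h1', h2'⟩ := PosDef.exists_spectralMatrix hXp'
  obtain ⟨W', q', hq', h3', h4'⟩ := PosDef.exists_spectralMatrix hYp'
  have hres : ∀ t : ℝ, 0 ≤ t → resolventForm U' W' p' q' t ≤ resolventForm U W p q t := by
    intro t ht
    obtain ⟨Z, hZ⟩ := exists_resolventTest_eq U' W' hp' hq' ht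
    rw [← hZ, ← h1', ← h3', resolventTest_map ε hX hY, h1, h3]
    exact resolventTest_le U W hp hq ht _
  have hmono : ∀ t : ℝ, 0 ≤ t → logForm U' W' p' q' t ≤ logForm U W p q t := by
    have hd : ∀ t : ℝ, 0 ≤ t → HasDerivAt (fun t => logForm U W p q t - logForm U' W' p' q' t)
        (resolventForm U W p q t - resolventForm U' W' p' q' t) t := fun t ht =>
      (hasDerivAt_logForm U W hp hq ht).sub (hasDerivAt_logForm U' W' hp' hq' ht)
    have hM : MonotoneOn (fun t => logForm U W p q t - logForm U' W' p' q' t) (Set.Ici 0) := by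
      refine monotoneOn_of_deriv_nonneg (convex_Ici 0)
        (fun t ht => (hd t ht).continuousAt.continuousWithinAt) ?_ ?_
      · intro t ht
        exact (hd t (interior_subset ht)).differentiableAt.differentiableWithinAt
      · intro t ht
        rw [(hd t (interior_subset ht)).deriv]
        exact sub_nonneg.2 (hres t (interior_subset ht))
    intro t ht
    have := hM (Set.mem_Ici.2 le_rfl) (Set.mem_Ici.2 ht) ht
    simpa [logForm] using this
  have htX : X'.trace = X.trace := by simpa using hX 1
  have htY : Y'.trace = Y.trace := by simpa using hY 1
  have hlim := le_of_tendsto_of_tendsto (tendsto_logForm U' W' (q := q') hp')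
    (tendsto_logForm U W (q := q) hp) (by
      filter_upwards [eventually_ge_atTop 0] with t ht
      rw [← trace_spectralMatrix_left, ← trace_spectralMatrix_left, ← h1, ← h1', htX]
      exact sub_le_sub_right (hmono t ht) _)
  rw [divergence_eq_sub_add h1 h3 h2 h4, divergence_eq_sub_add h1' h3' h2' h4', htX, htY]
  linarith

end DataProcessing

section PartialTrace

open Matrix

/-- The partial trace along a factorization of the basis labels. -/
def partialTrace {n a c : Type*} [Fintype c] (e : n ≃ a × c) (X : Matrix n n ℂ) : Matrix a a ℂ :=
  fun i j => ∑ k : c, X (e.symm (i, k)) (e.symm (j, k))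

theorem PosDef.partialTrace {n a c : Type*} [Fintype c] [Nonempty c] (e : n ≃ a × c)
    {X : Matrix n n ℂ} (hX : X.PosDef) :
    (partialTrace e X).PosDef := by
  have h : QuantumGraph.partialTrace e X
      = ∑ k : c, X.submatrix (fun i => e.symm (i, k)) (fun i => e.symm (i, k)) := by
    ext i j
    simp [QuantumGraph.partialTrace, Matrix.sum_apply]
  rw [h]
  refine posDef_sum Finset.univ_nonempty fun k _ => hX.submatrix fun i j hij => ?_
  simpa using hij

variable {n a c : Type*} [Fintype n] [DecidableEq n] [Fintype a] [DecidableEq a]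
  [Fintype c] [DecidableEq c]

/-- The amplification `M ↦ M ⊗ 1` along a factorization of the basis labels. -/
def amplify (e : n ≃ a × c) : Matrix a a ℂ →⋆ₐ[ℂ] Matrix n n ℂ where
  toFun M := (M ⊗ₖ (1 : Matrix c c ℂ)).submatrix e e
  map_one' := by simp
  map_mul' M N := by
    rw [submatrix_mul_equiv, ← mul_kronecker_mul, one_mul]
  map_zero' := by simp
  map_add' M N := by rw [add_kronecker, submatrix_add]; rfl
  commutes' r := by
    rw [Algebra.algebraMap_eq_smul_one, Algebra.algebraMap_eq_smul_one, smul_kronecker]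
    ext i j
    simp [submatrix_apply, Matrix.one_apply]
  map_star' M := by
    simp only [star_eq_conjTranspose, conjTranspose_submatrix, conjTranspose_kronecker,
      conjTranspose_one]

theorem amplify_apply (e : n ≃ a × c) (M : Matrix a a ℂ) (i j : n) :
    amplify e M i j = M (e i).1 (e j).1 * (1 : Matrix c c ℂ) (e i).2 (e j).2 := rfl

theorem amplify_symm_apply (e : n ≃ a × c) (M : Matrix a a ℂ) (i j : a) (k l : c) :
    amplify e M (e.symm (i, k)) (e.symm (j, l)) = if k = l then M i j else 0 := by
  rw [amplify_apply, e.apply_symm_apply, e.apply_symm_apply, Matrix.one_apply, mul_ite, mul_one,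
    mul_zero]

theorem trace_partialTrace_mul (e : n ≃ a × c) (X : Matrix n n ℂ) (M : Matrix a a ℂ) :
    (partialTrace e X * M).trace = (X * amplify e M).trace := by
  have h : ∀ (i : a) (k : c), (X * amplify e M) (e.symm (i, k)) (e.symm (i, k))
      = ∑ j, X (e.symm (i, k)) (e.symm (j, k)) * M j i := by
    intro i k
    rw [mul_apply, ← e.symm.sum_comp, Fintype.sum_prod_type]
    refine Finset.sum_congr rfl fun j _ => ?_
    rw [Finset.sum_eq_single k]
    · rw [amplify_symm_apply, if_pos rfl]
    · intro l _ hl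
      rw [amplify_symm_apply, if_neg hl, mul_zero]
    · simp
  rw [trace, trace, ← e.symm.sum_comp, Fintype.sum_prod_type]
  refine Finset.sum_congr rfl fun i _ => ?_
  rw [diag_apply, mul_apply]
  simp only [diag_apply, h, partialTrace, Finset.sum_mul]
  exact Finset.sum_comm

theorem PosDef.amplify (e : n ≃ a × c) {M : Matrix a a ℂ} (hM : M.PosDef) :
    (amplify e M).PosDef :=
  (PosDef.kronecker hM PosDef.one).submatrix e.injective

theorem continuousOn_spectrum (f : ℝ → ℝ) {X : Matrix n n ℂ} :
    ContinuousOn f (spectrum ℝ X) :=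
  (finite_real_spectrum (𝕜 := ℂ) (A := X)).continuousOn f

theorem matLog_map (φ : Matrix a a ℂ →⋆ₐ[ℂ] Matrix n n ℂ) {X : Matrix a a ℂ}
    (hX : X.IsHermitian) : matLog (φ X) = φ (matLog X) := by
  have hc : Continuous φ := φ.toAlgHom.toLinearMap.continuous_of_finiteDimensional
  have h1 : IsSelfAdjoint (φ X) := IsSelfAdjoint.map (show IsSelfAdjoint X from hX) φ
  exact (StarAlgHom.map_cfc φ Real.log X (continuousOn_spectrum _) hc hX h1).symm

theorem IsHermitian.matLog (X : Matrix n n ℂ) : (matLog X).IsHermitian :=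
  cfc_predicate (p := IsSelfAdjoint) Real.log X

theorem matLog_exp {H : Matrix n n ℂ} (hH : H.IsHermitian) :
    matLog (NormedSpace.exp H) = H := by
  open scoped Matrix.Norms.L2Operator in
  exact CFC.log_exp H hH

theorem IsHermitian.posDef_exp {H : Matrix n n ℂ} (hH : H.IsHermitian) :
    (NormedSpace.exp H).PosDef := by
  have h : NormedSpace.exp H = cfc Real.exp H := by
    open scoped Matrix.Norms.L2Operator in
    exact (CFC.real_exp_eq_normedSpace_exp hH).symm
  obtain ⟨U, -, h2⟩ := IsHermitian.exists_spectralMatrix hH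
  rw [h, h2]
  refine (Matrix.IsUnit.posDef_star_right_conjugate_iff
    (U := (U : Matrix n n ℂ)) (Unitary.isUnit_coe)).2 ?_
  rw [posDef_diagonal_iff]
  intro i
  exact_mod_cast Real.exp_pos _

end PartialTrace

section Marginals

open Matrix

variable {V : Type*} [Fintype V] [DecidableEq V] {ι : V → Type*} [∀ v, Fintype (ι v)]
  [∀ v, DecidableEq (ι v)]

/-- `extend A` as a homomorphism of star algebras. -/
def extendHom (A : Finset V) : Op ι A →⋆ₐ[ℂ] GlobalOp ι := amplify (splitIdx ι A)

theorem extendHom_apply (A : Finset V) (M : Op ι A) : extendHom A M = extend A M := rfl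

theorem trace_reduced_mul (ρ : GlobalOp ι) (A : Finset V) (M : Op ι A) :
    (reduced ρ A * M).trace = (ρ * extend A M).trace :=
  trace_partialTrace_mul (splitIdx ι A) ρ M

theorem trace_reduced (ρ : GlobalOp ι) (A : Finset V) : (reduced ρ A).trace = ρ.trace := by
  have h := trace_reduced_mul ρ A 1
  rwa [← extendHom_apply, map_one, mul_one, mul_one] at h

theorem splitIdx_eq_iff {V : Type*} [DecidableEq V] {ι : V → Type*} (A : Finset V)
    (x y : (v : V) → ι v) :
    (splitIdx ι A x).2 = (splitIdx ι A y).2 ↔ ∀ v, v ∉ A → x v = y v := by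
  simp [splitIdx, funext_iff]

theorem extend_apply {V : Type*} [Fintype V] [DecidableEq V] {ι : V → Type*}
    [∀ v, DecidableEq (ι v)] (A : Finset V) (M : Op ι A) (x y : (v : V) → ι v)
    [Decidable (∀ v, v ∉ A → x v = y v)] :
    extend A M x y = if ∀ v, v ∉ A → x v = y v then M (fun v => x v) (fun v => y v) else 0 := by
  have h : extend A M x y = M (fun v => x v) (fun v => y v)
      * (1 : Matrix ((v : {v // v ∉ A}) → ι v) ((v : {v // v ∉ A}) → ι v) ℂ)
        (splitIdx ι A x).2 (splitIdx ι A y).2 := rfl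
  rw [h, Matrix.one_apply]
  simp only [splitIdx_eq_iff, mul_ite, mul_one, mul_zero]

/-- The splitting `H_E ≅ H_A ⊗ H_C` on basis labels, for `E` the disjoint union of `A` and `C`. -/
def unionIdx (ι : V → Type*) {A C E : Finset V} (hd : Disjoint A C) (hE : A ∪ C = E) :
    Idx ι E ≃ Idx ι A × Idx ι C where
  toFun x := (fun v => x ⟨v, hE ▸ Finset.mem_union_left _ v.2⟩,
    fun v => x ⟨v, hE ▸ Finset.mem_union_right _ v.2⟩)
  invFun y := fun v => if h : v.1 ∈ A then y.1 ⟨v, h⟩ else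
    y.2 ⟨v, (Finset.mem_union.1 (hE.symm ▸ v.2)).resolve_left h⟩
  left_inv x := by
    funext v
    by_cases h : v.1 ∈ A <;> simp [h]
  right_inv y := by
    refine Prod.ext ?_ ?_
    · funext v
      simp
    · funext v
      have h : v.1 ∉ A := fun h => Finset.disjoint_left.1 hd h v.2
      simp [h]

theorem extend_amplify {A C E : Finset V} (hd : Disjoint A C) (hE : A ∪ C = E) (M : Op ι A) :
    extend E (amplify (unionIdx ι hd hE) M) = extend A M := by
  classical
  ext x y
  rw [extend_apply, extend_apply, amplify_apply, Matrix.one_apply]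
  have h2 : (unionIdx ι hd hE (fun v => x v)).2 = (unionIdx ι hd hE (fun v => y v)).2 ↔
      ∀ v ∈ C, x v = y v := by
    simp [unionIdx, funext_iff]
  have h3 : (∀ v, v ∉ A → x v = y v) ↔ (∀ v, v ∉ E → x v = y v) ∧ ∀ v ∈ C, x v = y v := by
    subst hE
    constructor
    · intro h
      exact ⟨fun v hv => h v fun hA => hv (Finset.mem_union_left _ hA),
        fun v hv => h v fun hA => Finset.disjoint_left.1 hd hA hv⟩
    · rintro ⟨h, h'⟩ v hv
      by_cases hC : v ∈ C
      · exact h' v hC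
      · exact h v (by simp [hv, hC])
  simp only [h2, h3, ite_and]
  split_ifs <;> simp [unionIdx]

theorem partialTrace_reduced {A C E : Finset V} (hd : Disjoint A C) (hE : A ∪ C = E)
    (ρ : GlobalOp ι) : partialTrace (unionIdx ι hd hE) (reduced ρ E) = reduced ρ A := by
  rw [ext_iff_trace_mul_right]
  intro M
  rw [trace_partialTrace_mul, trace_reduced_mul, trace_reduced_mul, extend_amplify]

theorem reduced_posDef {V : Type*} [Fintype V] [DecidableEq V] {ι : V → Type*}
    [∀ v, Fintype (ι v)] {ρ : GlobalOp ι} (hρ : IsStrictDensity ρ) (A : Finset V) :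
    (reduced ρ A).PosDef := by
  have hne : Nonempty ((v : V) → ι v) := by
    by_contra h
    rw [not_nonempty_iff] at h
    have := hρ.2
    simp [trace] at this
  obtain ⟨x⟩ := hne
  have : Nonempty ((v : {v // v ∉ A}) → ι v) := ⟨fun v => x v⟩
  exact PosDef.partialTrace (splitIdx ι A) hρ.1

theorem reduced_one_trace {ρ : GlobalOp ι} (hρ : IsStrictDensity ρ) (A : Finset V) :
    (reduced ρ A).trace = 1 := (trace_reduced ρ A).trans hρ.2

/-- Monotonicity of the divergence of marginals. -/
theorem divergence_reduced_mono {ρ σ : GlobalOp ι} (hρ : IsStrictDensity ρ)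
    (hσ : IsStrictDensity σ) {A E : Finset V} (hAE : A ⊆ E) :
    divergence (reduced σ A) (reduced ρ A) ≤ divergence (reduced σ E) (reduced ρ E) := by
  have hd : Disjoint A (E \ A) := Finset.disjoint_sdiff
  have hE : A ∪ E \ A = E := Finset.union_sdiff_of_subset hAE
  refine divergence_le_of_trace_eq (amplify (unionIdx ι hd hE)) (reduced_posDef hσ E)
    (reduced_posDef hρ E) (reduced_posDef hσ A) (reduced_posDef hρ A) (fun M => ?_) fun M => ?_
  · rw [← partialTrace_reduced hd hE, trace_partialTrace_mul]
  · rw [← partialTrace_reduced hd hE, trace_partialTrace_mul]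

theorem partialTrace_amplify {V : Type*} [DecidableEq V] {ι : V → Type*} [∀ v, Fintype (ι v)]
    [∀ v, DecidableEq (ι v)] (A B : Finset V) (Z : Op ι A)
    (hB : Disjoint B (A \ B)) (hBE : B ∪ A \ B = A ∪ B)
    (hA : Disjoint A (B \ A)) (hAE : A ∪ B \ A = A ∪ B)
    (hFB : Disjoint (A ∩ B) (B \ A)) (hFBE : A ∩ B ∪ B \ A = B)
    (hFA : Disjoint (A ∩ B) (A \ B)) (hFAE : A ∩ B ∪ A \ B = A) :
    partialTrace (unionIdx ι hB hBE) (amplify (unionIdx ι hA hAE) Z)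
      = amplify (unionIdx ι hFB hFBE) (partialTrace (unionIdx ι hFA hFAE) Z) := by
  ext i j
  rw [amplify_apply]
  simp only [partialTrace, amplify_apply]
  rw [Finset.sum_mul]
  refine Finset.sum_congr rfl fun k _ => ?_
  have h1 : ∀ i : Idx ι B, (unionIdx ι hA hAE ((unionIdx ι hB hBE).symm (i, k))).1
      = (unionIdx ι hFA hFAE).symm ((unionIdx ι hFB hFBE i).1, k) := by
    intro i
    funext v
    by_cases h : v.1 ∈ B <;> simp [unionIdx, h]
  have h2 : ∀ i : Idx ι B, (unionIdx ι hA hAE ((unionIdx ι hB hBE).symm (i, k))).2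
      = (unionIdx ι hFB hFBE i).2 := by
    intro i
    funext v
    simp [unionIdx, (Finset.mem_sdiff.1 v.2).1]
  rw [h1, h1, Matrix.one_apply, Matrix.one_apply]
  simp only [h2]

/-- Strong subadditivity of the von Neumann entropy. -/
theorem entropy_union_add_entropy_inter_le {ρ : GlobalOp ι} (hρ : IsStrictDensity ρ)
    (A B : Finset V) :
    entropy (reduced ρ (A ∪ B)) + entropy (reduced ρ (A ∩ B))
      ≤ entropy (reduced ρ A) + entropy (reduced ρ B) := by
  have hB : Disjoint B (A \ B) := Finset.disjoint_sdiff
  have hBE : B ∪ A \ B = A ∪ B := by rw [Finset.union_sdiff_self_eq_union, Finset.union_comm]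
  have hA : Disjoint A (B \ A) := Finset.disjoint_sdiff
  have hAE : A ∪ B \ A = A ∪ B := Finset.union_sdiff_self_eq_union
  have hFB : Disjoint (A ∩ B) (B \ A) :=
    Finset.disjoint_sdiff.mono_left Finset.inter_subset_left
  have hFBE : A ∩ B ∪ B \ A = B := by ext; simp; tauto
  have hFA : Disjoint (A ∩ B) (A \ B) :=
    Finset.disjoint_sdiff.mono_left Finset.inter_subset_right
  have hFAE : A ∩ B ∪ A \ B = A := by ext; simp; tauto
  have hpA := reduced_posDef hρ A
  have hpB := reduced_posDef hρ B
  have hpE := reduced_posDef hρ (A ∪ B)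
  have hpF := reduced_posDef hρ (A ∩ B)
  have hY : ∀ M, (amplify (unionIdx ι hFB hFBE) (reduced ρ (A ∩ B)) * M).trace
      = (amplify (unionIdx ι hA hAE) (reduced ρ A) * amplify (unionIdx ι hB hBE) M).trace := by
    intro M
    rw [← partialTrace_reduced hFA hFAE ρ, ← partialTrace_amplify, trace_partialTrace_mul]
  have hX : ∀ M, (reduced ρ B * M).trace
      = (reduced ρ (A ∪ B) * amplify (unionIdx ι hB hBE) M).trace := by
    intro M
    rw [← partialTrace_reduced hB hBE ρ, trace_partialTrace_mul]
  have h := divergence_le_of_trace_eq (amplify (unionIdx ι hB hBE)) hpE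
    (PosDef.amplify (unionIdx ι hA hAE) hpA) hpB (PosDef.amplify (unionIdx ι hFB hFBE) hpF) hX hY
  have htr : (amplify (unionIdx ι hFB hFBE) (reduced ρ (A ∩ B))).trace
      = (amplify (unionIdx ι hA hAE) (reduced ρ A)).trace := by
    simpa using hY 1
  rw [divergence, divergence, matLog_map _ hpA.1, matLog_map _ hpF.1, ← trace_partialTrace_mul,
    ← trace_partialTrace_mul, partialTrace_reduced, partialTrace_reduced, htr,
    trace_reduced, trace_reduced] at h
  simp only [entropy]
  linarith

theorem entropy_reduced_univ (ρ : GlobalOp ι) (hρ : ρ.PosDef) :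
    entropy (reduced ρ Finset.univ) = entropy ρ := by
  have hempty : IsEmpty {v // v ∉ (Finset.univ : Finset V)} := ⟨fun v => v.2 (Finset.mem_univ _)⟩
  have h1 : extend Finset.univ (reduced ρ Finset.univ) = ρ := by
    classical
    ext x y
    rw [extend_apply, if_pos (fun v hv => absurd (Finset.mem_univ v) hv)]
    rw [reduced, Fintype.sum_unique]
    congr 1 <;> funext v <;> simp [splitIdx, Equiv.piEquivPiSubtypeProd]
  have hH : (reduced ρ Finset.univ).IsHermitian := by
    have : Nonempty ((v : {v // v ∉ (Finset.univ : Finset V)}) → ι v) := ⟨fun v => hempty.elim v⟩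
    exact (PosDef.partialTrace (splitIdx ι Finset.univ) hρ).1
  unfold entropy
  rw [trace_reduced_mul, ← extendHom_apply, ← matLog_map _ hH, extendHom_apply, h1]

end Marginals

section Trees

open SimpleGraph

variable {α : Type*}

theorem exists_parent {J : SimpleGraph α} (hJ : J.Connected) (r : α) :
    ∃ par : α → α, ∀ a, a ≠ r → J.Adj a (par a) ∧ J.dist (par a) r < J.dist a r := by
  have h : ∀ a, ∃ b, a ≠ r → J.Adj a b ∧ J.dist b r < J.dist a r := by
    intro a
    by_cases har : a = r
    · exact ⟨a, fun h => absurd har h⟩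
    · obtain ⟨p, hp⟩ := hJ.exists_walk_length_eq_dist a r
      cases p with
      | nil => exact absurd rfl har
      | @cons _ b _ hab q =>
        refine ⟨b, fun _ => ⟨hab, ?_⟩⟩
        rw [← hp, Walk.length_cons]
        exact Nat.lt_succ_of_le (dist_le q)
  choose par hpar using h
  exact ⟨par, hpar⟩

theorem sum_edges_eq_sum_parent [Fintype α] [DecidableEq α] {J : SimpleGraph α} (hJ : J.IsTree)
    {r : α} {par : α → α} (hpar : ∀ a, a ≠ r → J.Adj a (par a) ∧ J.dist (par a) r < J.dist a r)
    {E : Finset (Sym2 α)} (hE : ∀ e, e ∈ E ↔ e ∈ J.edgeSet) (g : Sym2 α → ℝ) :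
    ∑ e ∈ E, g e = ∑ a ∈ Finset.univ.erase r, g s(a, par a) := by
  have hinj : Set.InjOn (fun a => s(a, par a)) (Finset.univ.erase r : Finset α) := by
    intro a ha b hb hab
    have ha' := hpar a (Finset.ne_of_mem_erase ha)
    have hb' := hpar b (Finset.ne_of_mem_erase hb)
    rcases Sym2.eq_iff.1 hab with h | h
    · exact h.1
    · rw [h.2] at ha'
      rw [← h.1] at hb'
      exact absurd (ha'.2.trans hb'.2) (lt_irrefl _)
  have himg : (Finset.univ.erase r).image (fun a => s(a, par a)) = E := by
    refine Finset.eq_of_subset_of_card_le ?_ ?_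
    · intro e he
      obtain ⟨a, ha, rfl⟩ := Finset.mem_image.1 he
      exact (hE _).2 (hpar a (Finset.ne_of_mem_erase ha)).1
    · rw [Finset.card_image_of_injOn hinj, Finset.card_erase_of_mem (Finset.mem_univ r),
        Finset.card_univ]
      have h1 := (isTree_iff_connected_and_card.1 hJ).2
      have h2 : Nat.card J.edgeSet = E.card := by
        rw [← Nat.card_eq_finsetCard]
        exact Nat.card_congr (Equiv.subtypeEquivRight fun e => (hE e).symm)
      rw [h2, Nat.card_eq_fintype_card] at h1
      omega
  rw [← himg, Finset.sum_image hinj]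

theorem exists_walk_notMem_support {J : SimpleGraph α} {r a : α} {par : α → α}
    (hpar : ∀ a, a ≠ r → J.Adj a (par a) ∧ J.dist (par a) r < J.dist a r) (har : a ≠ r) :
    ∀ (k : ℕ) (b : α), J.dist b r = k → b ≠ a → J.dist b r ≤ J.dist a r →
      ∃ w : J.Walk b r, a ∉ w.support := by
  intro k
  induction k using Nat.strong_induction_on with
  | _ k ih =>
    intro b hbk hba hle
    by_cases hbr : b = r
    · subst hbr
      exact ⟨Walk.nil, by simpa using har⟩
    · obtain ⟨hadj, hlt⟩ := hpar b hbr
      obtain ⟨w, hw⟩ := ih _ (hbk ▸ hlt) (par b) rfl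
        (fun h => by rw [h] at hlt; omega) (by omega)
      refine ⟨Walk.cons hadj w, ?_⟩
      rw [Walk.support_cons, List.mem_cons, not_or]
      exact ⟨hba.symm, hw⟩

theorem exists_isPath_parent_mem {J : SimpleGraph α} {r a b : α} {par : α → α}
    (hpar : ∀ a, a ≠ r → J.Adj a (par a) ∧ J.dist (par a) r < J.dist a r) (har : a ≠ r)
    (hba : b ≠ a) (hle : J.dist b r ≤ J.dist a r) :
    ∃ p : J.Walk a b, p.IsPath ∧ par a ∈ p.support := by
  classical
  obtain ⟨hadj, hlt⟩ := hpar a har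
  obtain ⟨w, hw⟩ := exists_walk_notMem_support hpar har _ b rfl hba hle
  obtain ⟨w', hw'⟩ := exists_walk_notMem_support hpar har _ (par a) rfl hadj.ne' hlt.le
  refine ⟨Walk.cons hadj (w'.append w.reverse).bypass, ?_, by simp⟩
  rw [Walk.cons_isPath_iff]
  refine ⟨Walk.bypass_isPath _, fun h => ?_⟩
  have h1 := Walk.support_bypass_subset_support _ h
  rw [Walk.mem_support_append_iff, Walk.support_reverse, List.mem_reverse] at h1
  exact h1.elim hw' hw

variable {V : Type*} [DecidableEq V]

/-- A submodular function is bounded along a subtree with the running intersection property. -/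
theorem submodular_subtree_le [DecidableEq α] {J : SimpleGraph α} {c : α → Finset V}
    (hc : ∀ (a b : α) (p : J.Walk a b), p.IsPath → ∀ d ∈ p.support, c a ∩ c b ⊆ c d)
    {f : Finset V → ℝ} (hf : ∀ A B, f (A ∪ B) + f (A ∩ B) ≤ f A + f B) {r : α} {par : α → α}
    (hpar : ∀ a, a ≠ r → J.Adj a (par a) ∧ J.dist (par a) r < J.dist a r) (W : Finset α) :
    r ∈ W → (∀ a ∈ W, a ≠ r → par a ∈ W) →
      f (W.biUnion c) + ∑ a ∈ W.erase r, f (c a ∩ c (par a)) ≤ ∑ a ∈ W, f (c a) := by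
  induction W using Finset.strongInduction with
  | H W ih =>
    intro hr hcl
    rcases (W.erase r).eq_empty_or_nonempty with he | hne
    · have hW : W = {r} := by
        rw [← Finset.insert_erase hr, he]
        rfl
      subst hW
      simp
    · obtain ⟨a, ha, hmax⟩ := Finset.exists_max_image _ (fun a => J.dist a r) hne
      have har := Finset.ne_of_mem_erase ha
      have haW := Finset.mem_of_mem_erase ha
      obtain ⟨hadj, hlt⟩ := hpar a har
      have hmax' : ∀ b ∈ W, J.dist b r ≤ J.dist a r := by
        intro b hb
        by_cases hbr : b = r
        · subst hbr; simp
        · exact hmax b (Finset.mem_erase.2 ⟨hbr, hb⟩)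
      have hcl' : ∀ b ∈ W.erase a, b ≠ r → par b ∈ W.erase a := by
        intro b hb hbr
        refine Finset.mem_erase.2 ⟨fun h => ?_, hcl b (Finset.mem_of_mem_erase hb) hbr⟩
        have h1 := (hpar b hbr).2
        rw [h] at h1
        exact absurd (hmax' b (Finset.mem_of_mem_erase hb)) (not_le.2 h1)
      have h1 := ih (W.erase a) (Finset.erase_ssubset haW)
        (Finset.mem_erase.2 ⟨har.symm, hr⟩) hcl'
      have hpa : par a ∈ W.erase a := Finset.mem_erase.2 ⟨hadj.ne', hcl a haW har⟩
      have hint : (W.erase a).biUnion c ∩ c a = c a ∩ c (par a) := by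
        ext v
        simp only [Finset.mem_inter, Finset.mem_biUnion]
        constructor
        · rintro ⟨⟨b, hb, hvb⟩, hva⟩
          obtain ⟨p, hp, hmem⟩ := exists_isPath_parent_mem hpar har (Finset.ne_of_mem_erase hb)
            (hmax' b (Finset.mem_of_mem_erase hb))
          exact ⟨hva, hc a b p hp _ hmem (Finset.mem_inter.2 ⟨hva, hvb⟩)⟩
        · rintro ⟨hva, hvp⟩
          exact ⟨⟨par a, hpa, hvp⟩, hva⟩
      have hun : W.biUnion c = (W.erase a).biUnion c ∪ c a := by
        conv_lhs => rw [← Finset.insert_erase haW]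
        rw [Finset.biUnion_insert, Finset.union_comm]
      have h2 := hf ((W.erase a).biUnion c) (c a)
      rw [hint, ← hun] at h2
      have h3 := Finset.add_sum_erase W (fun a => f (c a)) haW
      have h4 := Finset.add_sum_erase (W.erase r) (fun a => f (c a ∩ c (par a))) ha
      rw [Finset.erase_right_comm] at h4
      linarith

end Trees

section JunctionTrees

open SimpleGraph

variable {V : Type*} [Fintype V] [DecidableEq V] {G : SimpleGraph V}

theorem mem_treeEdges {V : Type*} [Fintype V] {G : SimpleGraph V} {J : SimpleGraph (MaxClique G)}
    (e : Sym2 (MaxClique G)) : e ∈ treeEdges J ↔ e ∈ J.edgeSet := by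
  classical
  simp [treeEdges]

theorem sum_separators (J : SimpleGraph (MaxClique G)) {M : Type*} [AddCommMonoid M]
    (g : Finset V → M) :
    ∑ D ∈ separators J, multiplicity J D • g D = ∑ e ∈ treeEdges J, g (pairInter e) :=
  (Finset.sum_comp g pairInter).symm

theorem exists_maxClique_superset {V : Type*} [Fintype V] (G : SimpleGraph V) {s : Finset V}
    (hs : G.IsClique (s : Set V)) : ∃ C : MaxClique G, s ⊆ C.1 := by
  obtain ⟨C, hsC, hC⟩ := (Set.toFinite {s : Finset V | G.IsClique (s : Set V)}).exists_le_maximal hs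
  exact ⟨⟨C, hC⟩, hsC⟩

theorem biUnion_maxClique (G : SimpleGraph V) :
    (Finset.univ : Finset (MaxClique G)).biUnion (fun C => C.1) = Finset.univ := by
  ext v
  obtain ⟨C, hC⟩ := exists_maxClique_superset G (s := {v}) (by simp)
  simpa using ⟨C.1, C.2, hC (Finset.mem_singleton_self v)⟩

theorem submodular_univ_le {J : SimpleGraph (MaxClique G)} (hJ : IsJunctionTree G J)
    {f : Finset V → ℝ} (hf : ∀ A B, f (A ∪ B) + f (A ∩ B) ≤ f A + f B) :
    f Finset.univ + ∑ e ∈ treeEdges J, f (pairInter e) ≤ ∑ C : MaxClique G, f C.1 := by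
  classical
  obtain ⟨r⟩ := hJ.1.connected.nonempty
  obtain ⟨par, hpar⟩ := exists_parent hJ.1.connected r
  have h := submodular_subtree_le (c := fun C : MaxClique G => C.1) hJ.2 hf hpar Finset.univ
    (Finset.mem_univ _) fun _ _ _ => Finset.mem_univ _
  rw [sum_edges_eq_sum_parent hJ.1 hpar mem_treeEdges]
  rw [biUnion_maxClique] at h
  exact h

/-- A nonnegative monotone function vanishes on every clique once its alternating sum over the
junction tree is nonpositive. -/
theorem eq_zero_of_sum_le {J : SimpleGraph (MaxClique G)} (hJ : IsJunctionTree G J)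
    {f : Finset V → ℝ} (hmono : ∀ A B, A ⊆ B → f A ≤ f B) (hnn : ∀ A, 0 ≤ f A)
    (h : ∑ C : MaxClique G, f C.1 ≤ ∑ e ∈ treeEdges J, f (pairInter e)) (r : MaxClique G) :
    f r.1 = 0 := by
  classical
  obtain ⟨par, hpar⟩ := exists_parent hJ.1.connected r
  rw [sum_edges_eq_sum_parent hJ.1 hpar mem_treeEdges,
    ← Finset.add_sum_erase _ _ (Finset.mem_univ r)] at h
  have h2 : ∑ a ∈ Finset.univ.erase r, f (pairInter s(a, par a))
      ≤ ∑ a ∈ Finset.univ.erase r, f a.1 :=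
    Finset.sum_le_sum fun a _ => hmono _ _ Finset.inter_subset_left
  have h3 := hnn r.1
  linarith

end JunctionTrees

section LogCandidate

open Matrix

variable {V : Type*} [Fintype V] [DecidableEq V] {ι : V → Type*} [∀ v, Fintype (ι v)]
  [∀ v, DecidableEq (ι v)] {G : SimpleGraph V}

theorem exists_pairInter_subset {V : Type*} [DecidableEq V] {G : SimpleGraph V}
    (e : Sym2 (MaxClique G)) : ∃ C : MaxClique G, pairInter e ⊆ C.1 :=
  Sym2.ind (f := fun e => ∃ C : MaxClique G, pairInter e ⊆ C.1)
    (fun C _ => ⟨C, Finset.inter_subset_left⟩) e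

/-- The exponent of `logCandidate`, with the separators summed over the edges of the tree. -/
noncomputable def logExponent (J : SimpleGraph (MaxClique G)) (ρ : GlobalOp ι) : GlobalOp ι :=
  (∑ C : MaxClique G, extend C.1 (matLog (reduced ρ C.1)))
    - ∑ e ∈ treeEdges J, extend (pairInter e) (matLog (reduced ρ (pairInter e)))

theorem logCandidate_eq_exp (J : SimpleGraph (MaxClique G)) (ρ : GlobalOp ι) :
    logCandidate J ρ = NormedSpace.exp (logExponent J ρ) := by
  rw [logCandidate, logExponent, sum_separators J fun D => extend D (matLog (reduced ρ D))]

theorem globalInformation_eq (J : SimpleGraph (MaxClique G)) (ρ : GlobalOp ι) :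
    globalInformation J ρ = (∑ C : MaxClique G, entropy (reduced ρ C.1))
      - (∑ e ∈ treeEdges J, entropy (reduced ρ (pairInter e))) - entropy ρ := by
  rw [globalInformation, ← sum_separators J fun D => entropy (reduced ρ D)]
  simp only [nsmul_eq_mul]

theorem extend_matLog_isHermitian (A : Finset V) (X : Op ι A) :
    (extend A (matLog X)).IsHermitian := by
  have h : IsSelfAdjoint (matLog X) := IsHermitian.matLog X
  exact h.map (extendHom A)

theorem logExponent_isHermitian (J : SimpleGraph (MaxClique G)) (ρ : GlobalOp ι) :
    (logExponent J ρ).IsHermitian := by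
  have h : IsSelfAdjoint (logExponent J ρ) :=
    (isSelfAdjoint_sum _ fun _ _ => extend_matLog_isHermitian _ _).sub
      (isSelfAdjoint_sum _ fun _ _ => extend_matLog_isHermitian _ _)
  exact h

theorem matLog_logCandidate (J : SimpleGraph (MaxClique G)) (ρ : GlobalOp ι) :
    matLog (logCandidate J ρ) = logExponent J ρ := by
  rw [logCandidate_eq_exp, matLog_exp (logExponent_isHermitian J ρ)]

theorem logCandidate_posDef (J : SimpleGraph (MaxClique G)) (ρ : GlobalOp ι) :
    (logCandidate J ρ).PosDef := by
  rw [logCandidate_eq_exp]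
  exact IsHermitian.posDef_exp (logExponent_isHermitian J ρ)

theorem trace_mul_logExponent (J : SimpleGraph (MaxClique G)) (ρ σ : GlobalOp ι) :
    (σ * logExponent J ρ).trace.re
      = (∑ C : MaxClique G, (reduced σ C.1 * matLog (reduced ρ C.1)).trace.re)
        - ∑ e ∈ treeEdges J,
          (reduced σ (pairInter e) * matLog (reduced ρ (pairInter e))).trace.re := by
  simp only [logExponent, mul_sub, Finset.mul_sum, trace_sub, trace_sum, Complex.sub_re,
    Complex.re_sum, trace_reduced_mul]

theorem globalInformation_eq_trace (J : SimpleGraph (MaxClique G)) (ρ : GlobalOp ι) :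
    globalInformation J ρ = -(ρ * logExponent J ρ).trace.re - entropy ρ := by
  rw [globalInformation_eq, trace_mul_logExponent]
  simp only [entropy, Finset.sum_neg_distrib]
  ring

theorem divergence_logCandidate {J : SimpleGraph (MaxClique G)} {ρ : GlobalOp ι}
    (hρ : IsStrictDensity ρ) :
    divergence ρ (logCandidate J ρ) = -(ρ * logExponent J ρ).trace.re - entropy ρ - 1
      + (logCandidate J ρ).trace.re := by
  rw [divergence, matLog_logCandidate, hρ.2, entropy, Complex.one_re]
  ring

/-- Nonnegativity of the global information. -/
theorem globalInformation_nonneg {J : SimpleGraph (MaxClique G)} (hJ : IsJunctionTree G J)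
    {ρ : GlobalOp ι} (hρ : IsStrictDensity ρ) : 0 ≤ globalInformation J ρ := by
  have h := submodular_univ_le hJ (f := fun A => entropy (reduced ρ A))
    (entropy_union_add_entropy_inter_le hρ)
  rw [entropy_reduced_univ ρ hρ.1] at h
  rw [globalInformation_eq]
  linarith

theorem divergence_reduced {ρ σ : GlobalOp ι} (hρ : IsStrictDensity ρ)
    (hσ : IsStrictDensity σ) (A : Finset V) :
    divergence (reduced σ A) (reduced ρ A)
      = -entropy (reduced σ A) - (reduced σ A * matLog (reduced ρ A)).trace.re := by
  rw [divergence, reduced_one_trace hρ, reduced_one_trace hσ, entropy]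
  ring

/-- A logarithmic candidate of unit trace has the marginals of `ρ` on the cliques and on the
separators. -/
theorem reduced_logCandidate_eq {J : SimpleGraph (MaxClique G)} (hJ : IsJunctionTree G J)
    {ρ : GlobalOp ι} (hρ : IsStrictDensity ρ) (htr : (logCandidate J ρ).trace = 1)
    {A : Finset V} {C : MaxClique G} (hA : A ⊆ C.1) :
    reduced (logCandidate J ρ) A = reduced ρ A := by
  have hσ : IsStrictDensity (logCandidate J ρ) := ⟨logCandidate_posDef J ρ, htr⟩
  set σ := logCandidate J ρ with hσdef
  have hnn : ∀ A, 0 ≤ divergence (reduced σ A) (reduced ρ A) := fun A =>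
    divergence_nonneg (reduced_posDef hσ A) (reduced_posDef hρ A)
  have hmono : ∀ A B, A ⊆ B → divergence (reduced σ A) (reduced ρ A)
      ≤ divergence (reduced σ B) (reduced ρ B) := fun A B h => divergence_reduced_mono hρ hσ h
  have hsum : ∑ C : MaxClique G, divergence (reduced σ C.1) (reduced ρ C.1)
      ≤ ∑ e ∈ treeEdges J, divergence (reduced σ (pairInter e)) (reduced ρ (pairInter e)) := by
    have h1 := globalInformation_nonneg hJ hσ
    have h2 : entropy σ = -(σ * logExponent J ρ).trace.re := by
      rw [entropy, ← matLog_logCandidate]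
    rw [globalInformation_eq, h2, trace_mul_logExponent] at h1
    simp only [divergence_reduced hρ hσ, Finset.sum_sub_distrib, Finset.sum_neg_distrib]
    linarith
  have h0 := eq_zero_of_sum_le hJ (f := fun A => divergence (reduced σ A) (reduced ρ A))
    hmono hnn hsum C
  exact eq_of_divergence_eq_zero (reduced_posDef hσ A) (reduced_posDef hρ A)
    (le_antisymm ((hmono _ _ hA).trans h0.le) (hnn A))

theorem trace_logCandidate_mul_logExponent {J : SimpleGraph (MaxClique G)}
    (hJ : IsJunctionTree G J) {ρ : GlobalOp ι} (hρ : IsStrictDensity ρ)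
    (htr : (logCandidate J ρ).trace = 1) :
    (logCandidate J ρ * logExponent J ρ).trace.re = (ρ * logExponent J ρ).trace.re := by
  rw [trace_mul_logExponent, trace_mul_logExponent]
  refine congrArg₂ _ (Finset.sum_congr rfl fun C _ => ?_) (Finset.sum_congr rfl fun e _ => ?_)
  · rw [reduced_logCandidate_eq hJ hρ htr (le_refl C.1)]
  · obtain ⟨C, hC⟩ := exists_pairInter_subset e
    rw [reduced_logCandidate_eq hJ hρ htr hC]

end LogCandidate

section ParentTrees

open SimpleGraph

variable {α : Type*}

/-- The graph of a parent function with root `r`. -/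
def parentGraph (r : α) (par : α → α) : SimpleGraph α :=
  SimpleGraph.fromRel fun a b => a ≠ r ∧ b = par a

theorem parentGraph_adj {r a : α} {par : α → α} (har : a ≠ r) (hne : a ≠ par a) :
    (parentGraph r par).Adj a (par a) :=
  ⟨hne, Or.inl ⟨har, rfl⟩⟩

theorem parentGraph_connected {r : α} {par : α → α} {rank : α → ℕ}
    (h : ∀ a, a ≠ r → rank (par a) < rank a) : (parentGraph r par).Connected := by
  have hr : ∀ (k : ℕ) (a : α), rank a = k → (parentGraph r par).Reachable a r := by
    intro k
    induction k using Nat.strong_induction_on with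
    | _ k ih =>
      intro a hak
      by_cases har : a = r
      · rw [har]
      · have hlt := h a har
        have hne : a ≠ par a := fun he => by rw [← he] at hlt; exact lt_irrefl _ hlt
        exact (parentGraph_adj har hne).reachable.trans (ih _ (hak ▸ hlt) _ rfl)
  exact (connected_iff _).2 ⟨fun a b => (hr _ a rfl).trans (hr _ b rfl).symm, ⟨r⟩⟩

theorem parentGraph_isTree [Finite α] {r : α} {par : α → α} {rank : α → ℕ}
    (h : ∀ a, a ≠ r → rank (par a) < rank a) : (parentGraph r par).IsTree := by
  classical
  have := Fintype.ofFinite α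
  have hc := parentGraph_connected h
  refine isTree_iff_connected_and_card.2 ⟨hc, le_antisymm ?_ hc.card_vert_le_card_edgeSet_add_one⟩
  have hsub : (parentGraph r par).edgeSet
      ⊆ ((Finset.univ.erase r).image fun a => s(a, par a) : Finset (Sym2 α)) := by
    intro e
    induction e with
    | _ a b =>
      rintro ⟨-, ⟨ha, hb⟩ | ⟨hb, ha⟩⟩
      · rw [show b = par a from hb]
        exact Finset.mem_coe.2 (Finset.mem_image.2
          ⟨a, Finset.mem_erase.2 ⟨ha, Finset.mem_univ _⟩, rfl⟩)
      · rw [show a = par b from ha]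
        exact Finset.mem_coe.2 (Finset.mem_image.2
          ⟨b, Finset.mem_erase.2 ⟨hb, Finset.mem_univ _⟩, Sym2.eq_swap⟩)
  have h1 : Nat.card (parentGraph r par).edgeSet ≤ (Finset.univ.erase r).card := by
    refine le_trans ?_ (Finset.card_image_le (s := Finset.univ.erase r)
      (f := fun a => s(a, par a)))
    rw [Nat.card_coe_set_eq, ← Set.ncard_coe_finset]
    exact Set.ncard_le_ncard hsub (Finset.finite_toSet _)
  rw [Finset.card_erase_of_mem (Finset.mem_univ r), Finset.card_univ] at h1
  have h2 : 0 < Fintype.card α := Fintype.card_pos_iff.2 ⟨r⟩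
  rw [Nat.card_eq_fintype_card (α := α)]
  omega

theorem parentGraph_inter_subset [Finite α] {V : Type*} [DecidableEq V] {r : α} {par : α → α}
    {rank : α → ℕ} (h : ∀ a, a ≠ r → rank (par a) < rank a) (hinj : Function.Injective rank)
    {c : α → Finset V} (hc : ∀ a b, a ≠ r → rank b < rank a → c a ∩ c b ⊆ c (par a))
    (hr : ∀ a, rank r ≤ rank a) {a b : α} (p : (parentGraph r par).Walk a b) (hp : p.IsPath) :
    ∀ d ∈ p.support, c a ∩ c b ⊆ c d := by
  classical
  have key : ∀ (k : ℕ) (a b : α), rank a + rank b = k →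
      ∃ w : (parentGraph r par).Walk a b, ∀ d ∈ w.support, c a ∩ c b ⊆ c d := by
    intro k
    induction k using Nat.strong_induction_on with
    | _ k ih =>
      have hlt : ∀ a b : α, rank a + rank b = k → rank b < rank a →
          ∃ w : (parentGraph r par).Walk a b, ∀ d ∈ w.support, c a ∩ c b ⊆ c d := by
        intro a b hk hba
        have har : a ≠ r := fun he => absurd (hr b) (by rw [← he]; omega)
        have hpa := h a har
        have hne : a ≠ par a := fun he => by rw [← he] at hpa; exact lt_irrefl _ hpa
        obtain ⟨w, hw⟩ := ih (rank (par a) + rank b) (by omega) (par a) b rfl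
        refine ⟨Walk.cons (parentGraph_adj har hne) w, fun d hd => ?_⟩
        rw [Walk.support_cons, List.mem_cons] at hd
        rcases hd with rfl | hd
        · exact Finset.inter_subset_left
        · exact (Finset.subset_inter (hc a b har hba) Finset.inter_subset_right).trans (hw d hd)
      intro a b hk
      rcases lt_trichotomy (rank a) (rank b) with hab | hab | hab
      · obtain ⟨w, hw⟩ := hlt b a (by omega) hab
        refine ⟨w.reverse, fun d hd => ?_⟩
        rw [Walk.support_reverse, List.mem_reverse] at hd
        rw [Finset.inter_comm]
        exact hw d hd
      · obtain rfl := hinj hab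
        refine ⟨Walk.nil, fun d hd => ?_⟩
        rw [Walk.support_nil, List.mem_singleton] at hd
        rw [hd]
        exact Finset.inter_subset_left
      · exact hlt a b hk hab
  obtain ⟨w, hw⟩ := key _ a b rfl
  intro d hd
  refine hw d (w.support_bypass_subset_support ?_)
  rwa [((parentGraph_isTree h).existsUnique_path a b).unique (Walk.bypass_isPath w) hp]

end ParentTrees

section Cliques

variable {V : Type*} [DecidableEq V]

/-- The inclusion-maximal cliques inside `W`. -/
def IsMaxCliqueIn (G : SimpleGraph V) (W C : Finset V) : Prop :=
  Maximal (fun s : Finset V => s ⊆ W ∧ G.IsClique (s : Set V)) C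

/-- The neighbours of `z` in `W` are pairwise adjacent. -/
def IsSimplicialIn (G : SimpleGraph V) (W : Finset V) (z : V) : Prop :=
  ∀ x ∈ W, ∀ y ∈ W, G.Adj z x → G.Adj z y → x ≠ y → G.Adj x y

/-- The maximal cliques inside `W` can be enumerated with the running intersection property. -/
def HasRunningIntersection (G : SimpleGraph V) (W : Finset V) : Prop :=
  ∃ rank : Finset V → ℕ, (∀ C C', IsMaxCliqueIn G W C → IsMaxCliqueIn G W C' →
      rank C = rank C' → C = C') ∧
    ∀ C, IsMaxCliqueIn G W C → (∀ C', IsMaxCliqueIn G W C' → rank C ≤ rank C') ∨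
      ∃ P, IsMaxCliqueIn G W P ∧ rank P < rank C ∧
        ∀ C', IsMaxCliqueIn G W C' → rank C' < rank C → C ∩ C' ⊆ P

theorem exists_isMaxCliqueIn {V : Type*} [Finite V] {G : SimpleGraph V} {W s : Finset V}
    (hs : s ⊆ W) (hs' : G.IsClique (s : Set V)) : ∃ C, IsMaxCliqueIn G W C ∧ s ⊆ C := by
  obtain ⟨C, hsC, hC⟩ := (Set.toFinite
    {s : Finset V | s ⊆ W ∧ G.IsClique (s : Set V)}).exists_le_maximal ⟨hs, hs'⟩
  exact ⟨C, hC, hsC⟩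

open Classical in
/-- The maximal cliques after adding a simplicial vertex `v` with neighbourhood `N`. -/
theorem isMaxCliqueIn_insert_iff {G : SimpleGraph V} {W N : Finset V} {v : V} (hv : v ∉ W)
    (hN : ∀ x, x ∈ N ↔ x ∈ W ∧ G.Adj v x) (hclique : G.IsClique (N : Set V)) (C : Finset V) :
    IsMaxCliqueIn G (insert v W) C ↔ C = insert v N ∨ (IsMaxCliqueIn G W C ∧ C ≠ N) := by
  have hNW : N ⊆ W := fun x hx => ((hN x).1 hx).1
  have hvN : v ∉ N := fun h => hv (hNW h)
  have hK : G.IsClique ((insert v N : Finset V) : Set V) := by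
    rw [Finset.coe_insert]
    exact hclique.insert fun x hx _ => ((hN x).1 hx).2
  have hsub : ∀ s : Finset V, s ⊆ insert v W → G.IsClique (s : Set V) → v ∈ s →
      s ⊆ insert v N := by
    intro s hs hcl hvs x hx
    by_cases hxv : x = v
    · rw [hxv]; exact Finset.mem_insert_self _ _
    · refine Finset.mem_insert_of_mem ((hN x).2 ⟨?_, hcl hvs hx (Ne.symm hxv)⟩)
      exact (Finset.mem_insert.1 (hs hx)).resolve_left hxv
  constructor
  · intro hC
    by_cases hvC : v ∈ C
    · left
      exact hC.eq_of_le ⟨Finset.insert_subset_insert v hNW, hK⟩ (hsub C hC.1.1 hC.1.2 hvC)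
    · right
      have hCW : C ⊆ W := (Finset.subset_insert_iff_of_notMem hvC).1 hC.1.1
      refine ⟨⟨⟨hCW, hC.1.2⟩, fun s hs hCs => hC.2 ⟨hs.1.trans (Finset.subset_insert _ _), hs.2⟩ hCs⟩,
        ?_⟩
      rintro rfl
      exact hvC (hC.2 ⟨Finset.insert_subset_insert v hNW, hK⟩ (Finset.subset_insert v C)
        (Finset.mem_insert_self v C))
  · rintro (rfl | ⟨hC, hCN⟩)
    · exact ⟨⟨Finset.insert_subset_insert v hNW, hK⟩, fun s hs hKs =>
        hsub s hs.1 hs.2 (hKs (Finset.mem_insert_self v N))⟩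
    · refine ⟨⟨hC.1.1.trans (Finset.subset_insert _ _), hC.1.2⟩, fun s hs hCs => ?_⟩
      by_cases hvs : v ∈ s
      · exfalso
        have hCN' : C ⊆ N := by
          intro x hx
          exact (Finset.mem_insert.1 (hsub s hs.1 hs.2 hvs (hCs hx))).resolve_left
            fun h => hv (h ▸ hC.1.1 hx)
        exact hCN (hC.eq_of_le ⟨hNW, hclique⟩ hCN')
      · exact hC.2 ⟨(Finset.subset_insert_iff_of_notMem hvs).1 hs.1, hs.2⟩ hCs

theorem HasRunningIntersection.insert [Finite V] {G : SimpleGraph V} {W : Finset V} {v : V}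
    (h : HasRunningIntersection G W) (hv : v ∉ W) (hs : IsSimplicialIn G W v) :
    HasRunningIntersection G (insert v W) := by
  classical
  have := Fintype.ofFinite V
  set N := W.filter (G.Adj v) with hNdef
  have hN : ∀ x, x ∈ N ↔ x ∈ W ∧ G.Adj v x := fun x => Finset.mem_filter
  have hNW : N ⊆ W := Finset.filter_subset _ _
  have hvN : v ∉ N := fun h => hv (hNW h)
  have hclique : G.IsClique (N : Set V) := by
    intro x hx y hy hxy
    obtain ⟨hxW, hxv⟩ := (hN x).1 hx
    obtain ⟨hyW, hyv⟩ := (hN y).1 hy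
    exact hs x hxW y hyW hxv hyv hxy
  have hiff := isMaxCliqueIn_insert_iff hv hN hclique
  have hvmem : ∀ C, IsMaxCliqueIn G W C → v ∉ C := fun C hC h => hv (hC.1.1 h)
  obtain ⟨rank, hinj, hrip⟩ := h
  by_cases hNmax : IsMaxCliqueIn G W N
  · have herase : ∀ C, IsMaxCliqueIn G (Insert.insert v W) C → IsMaxCliqueIn G W (C.erase v) := by
      intro C hC
      rcases (hiff C).1 hC with rfl | ⟨hC, -⟩
      · rwa [Finset.erase_insert hvN]
      · rwa [Finset.erase_eq_of_notMem (hvmem C hC)]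
    have hlift : ∀ P, IsMaxCliqueIn G W P →
        ∃ Q, IsMaxCliqueIn G (Insert.insert v W) Q ∧ Q.erase v = P := by
      intro P hP
      by_cases hPN : P = N
      · exact ⟨Insert.insert v N, (hiff _).2 (Or.inl rfl), by rw [Finset.erase_insert hvN, hPN]⟩
      · exact ⟨P, (hiff _).2 (Or.inr ⟨hP, hPN⟩), Finset.erase_eq_of_notMem (hvmem P hP)⟩
    have hmemv : ∀ C, IsMaxCliqueIn G (Insert.insert v W) C → v ∈ C → C = Insert.insert v N := by
      intro C hC hvC
      exact ((hiff C).1 hC).resolve_right fun h => hvmem C h.1 hvC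
    have heinj : ∀ C C', IsMaxCliqueIn G (Insert.insert v W) C →
        IsMaxCliqueIn G (Insert.insert v W) C' → C.erase v = C'.erase v → C = C' := by
      intro C C' hC hC' he
      rcases (hiff C).1 hC with h1 | ⟨h1, h1'⟩ <;> rcases (hiff C').1 hC' with h2 | ⟨h2, h2'⟩
      · rw [h1, h2]
      · rw [h1, Finset.erase_insert hvN, Finset.erase_eq_of_notMem (hvmem _ h2)] at he
        exact absurd he.symm h2'
      · rw [h2, Finset.erase_insert hvN, Finset.erase_eq_of_notMem (hvmem _ h1)] at he
        exact absurd he h1'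
      · rwa [Finset.erase_eq_of_notMem (hvmem _ h1), Finset.erase_eq_of_notMem (hvmem _ h2)] at he
    refine ⟨fun C => rank (C.erase v), fun C C' hC hC' he =>
      heinj C C' hC hC' (hinj _ _ (herase C hC) (herase C' hC') he), fun C hC => ?_⟩
    rcases hrip _ (herase C hC) with hmin | ⟨P, hP, hlt, hsub⟩
    · exact Or.inl fun C' hC' => hmin _ (herase C' hC')
    · obtain ⟨Q, hQ, rfl⟩ := hlift P hP
      refine Or.inr ⟨Q, hQ, hlt, fun C' hC' hlt' x hx => ?_⟩
      obtain ⟨hxC, hxC'⟩ := Finset.mem_inter.1 hx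
      have hxv : x ≠ v := by
        rintro rfl
        rw [hmemv C hC hxC, hmemv C' hC' hxC'] at hlt'
        exact lt_irrefl _ hlt'
      exact Finset.mem_of_mem_erase (hsub _ (herase C' hC') hlt' (Finset.mem_inter.2
        ⟨Finset.mem_erase.2 ⟨hxv, hxC⟩, Finset.mem_erase.2 ⟨hxv, hxC'⟩⟩))
  · set K := Insert.insert v N with hK
    set M := Finset.univ.sup rank + 1 with hM
    have hltM : ∀ C, rank C < M := fun C =>
      Nat.lt_succ_of_le (Finset.le_sup (f := rank) (Finset.mem_univ C))
    have hiff' : ∀ C, IsMaxCliqueIn G (Insert.insert v W) C ↔ C = K ∨ IsMaxCliqueIn G W C := by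
      intro C
      rw [hiff]
      refine or_congr Iff.rfl ⟨fun h => h.1, fun h => ⟨h, ?_⟩⟩
      rintro rfl
      exact hNmax h
    have hneK : ∀ C, IsMaxCliqueIn G W C → C ≠ K := by
      rintro C hC rfl
      exact hvmem _ hC (Finset.mem_insert_self v N)
    have hrank : ∀ C, IsMaxCliqueIn G W C → (if C = K then M else rank C) = rank C :=
      fun C hC => if_neg (hneK C hC)
    refine ⟨fun C => if C = K then M else rank C, fun C C' hC hC' he => ?_, fun C hC => ?_⟩
    · dsimp only at he
      rcases (hiff' C).1 hC with rfl | h1 <;> rcases (hiff' C').1 hC' with h2 | h2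
      · exact h2.symm
      · rw [if_pos rfl, hrank _ h2] at he
        exact absurd he (hltM C').ne'
      · rw [if_pos h2, hrank _ h1] at he
        exact absurd he (hltM C).ne
      · rw [hrank _ h1, hrank _ h2] at he
        exact hinj _ _ h1 h2 he
    · dsimp only
      rcases (hiff' C).1 hC with rfl | h1
      · obtain ⟨P, hP, hNP⟩ := exists_isMaxCliqueIn hNW hclique
        refine Or.inr ⟨P, (hiff' P).2 (Or.inr hP), ?_, fun C' hC' hlt x hx => ?_⟩
        · rw [if_pos rfl, hrank _ hP]
          exact hltM P
        · rcases (hiff' C').1 hC' with rfl | h2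
          · exact absurd hlt (lt_irrefl _)
          · obtain ⟨hxK, hxC'⟩ := Finset.mem_inter.1 hx
            rcases Finset.mem_insert.1 hxK with rfl | hxN
            · exact absurd hxC' (hvmem _ h2)
            · exact hNP hxN
      · rw [hrank _ h1]
        rcases hrip C h1 with hmin | ⟨P, hP, hlt, hsub⟩
        · refine Or.inl fun C' hC' => ?_
          rcases (hiff' C').1 hC' with rfl | h2
          · rw [if_pos rfl]
            exact (hltM C).le
          · rw [hrank _ h2]
            exact hmin _ h2
        · refine Or.inr ⟨P, (hiff' P).2 (Or.inr hP), by rwa [hrank _ hP], fun C' hC' hlt' => ?_⟩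
          rcases (hiff' C').1 hC' with rfl | h2
          · rw [if_pos rfl] at hlt'
            exact absurd hlt' (hltM C).le.not_gt
          · rw [hrank _ h2] at hlt'
            exact hsub _ h2 hlt'

theorem hasRunningIntersection_empty (G : SimpleGraph V) : HasRunningIntersection G ∅ := by
  have h : ∀ C, IsMaxCliqueIn G ∅ C → C = ∅ := fun C hC => Finset.subset_empty.1 hC.1.1
  exact ⟨fun _ => 0, fun C C' hC hC' _ => (h C hC).trans (h C' hC').symm,
    fun C hC => Or.inl fun _ _ => le_rfl⟩

theorem hasRunningIntersection_of_simplicial [Finite V] {G : SimpleGraph V}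
    (h : ∀ W : Finset V, W.Nonempty → ∃ z ∈ W, IsSimplicialIn G W z) (W : Finset V) :
    HasRunningIntersection G W := by
  induction W using Finset.strongInduction with
  | H W ih =>
    rcases W.eq_empty_or_nonempty with rfl | hne
    · exact hasRunningIntersection_empty G
    · obtain ⟨z, hz, hs⟩ := h W hne
      have h1 := ih (W.erase z) (Finset.erase_ssubset hz)
      rw [← Finset.insert_erase hz]
      exact h1.insert (Finset.notMem_erase z W) fun x hx y hy =>
        hs x (Finset.mem_of_mem_erase hx) y (Finset.mem_of_mem_erase hy)

theorem exists_junctionTree_of_hasRunningIntersection [Fintype V] {G : SimpleGraph V}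
    (h : HasRunningIntersection G Finset.univ) :
    ∃ J : SimpleGraph (MaxClique G), IsJunctionTree G J := by
  classical
  have hmax : ∀ C : Finset V, IsMaxCliqueIn G Finset.univ C ↔
      Maximal (fun s : Finset V => G.IsClique (s : Set V)) C := by
    intro C
    simp [IsMaxCliqueIn]
  obtain ⟨rank, hinj, hrip⟩ := h
  simp only [hmax] at hinj hrip
  obtain ⟨C₀, -⟩ := exists_maxClique_superset G (s := ∅) (by simp)
  obtain ⟨r, -, hr⟩ := Finset.exists_min_image (Finset.univ : Finset (MaxClique G))
    (fun C => rank C.1) ⟨C₀, Finset.mem_univ _⟩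
  have hr' : ∀ C : MaxClique G, rank r.1 ≤ rank C.1 := fun C => hr C (Finset.mem_univ C)
  have hpar : ∀ C : MaxClique G, ∃ P : MaxClique G, C ≠ r → rank P.1 < rank C.1 ∧
      ∀ C' : MaxClique G, rank C'.1 < rank C.1 → C.1 ∩ C'.1 ⊆ P.1 := by
    intro C
    rcases hrip C.1 C.2 with hmin | ⟨P, hP, hlt, hsub⟩
    · exact ⟨C, fun hne => absurd (Subtype.ext (hinj _ _ C.2 r.2
        (le_antisymm (hmin _ r.2) (hr' C)))) hne⟩
    · exact ⟨⟨P, hP⟩, fun _ => ⟨hlt, fun C' hC' => hsub _ C'.2 hC'⟩⟩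
  choose par hpar using hpar
  have hlt : ∀ C : MaxClique G, C ≠ r → rank (par C).1 < rank C.1 := fun C hC => (hpar C hC).1
  refine ⟨parentGraph r par, parentGraph_isTree (rank := fun C => rank C.1) hlt,
    fun C₁ C₂ p hp => ?_⟩
  exact parentGraph_inter_subset (rank := fun C : MaxClique G => rank C.1)
    (c := fun C : MaxClique G => C.1) hlt
    (fun C C' he => Subtype.ext (hinj _ _ C.2 C'.2 he))
    (fun C C' hC => (hpar C hC).2 C') hr' p hp

end Cliques

section Simplicial

open SimpleGraph

variable {V : Type*}

/-- A shortest path has no chords. -/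
theorem mem_edges_of_length_eq_dist {H : SimpleGraph V} {x y : V} (p : H.Walk x y)
    (hp : p.length = H.dist x y) {a b : V} (ha : a ∈ p.support) (hb : b ∈ p.support)
    (hab : H.Adj a b) : s(a, b) ∈ p.edges := by
  obtain ⟨i, rfl, hi⟩ := Walk.mem_support_iff_exists_getVert.1 ha
  obtain ⟨j, rfl, hj⟩ := Walk.mem_support_iff_exists_getVert.1 hb
  have key : ∀ i j, i ≤ p.length → j ≤ p.length → i < j → H.Adj (p.getVert i) (p.getVert j) →
      s(p.getVert i, p.getVert j) ∈ p.edges := by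
    intro i j hi hj hij hadj
    have h1 := dist_le ((p.take i).append (Walk.cons hadj (p.drop j)))
    rw [Walk.length_append, Walk.length_cons, Walk.take_length, Walk.drop_length, ← hp] at h1
    have hji : j = i + 1 := by omega
    subst hji
    rw [← Walk.mem_edges_toSubgraph]
    exact Walk.toSubgraph_adj_getVert p (by omega)
  rcases lt_trichotomy i j with hij | rfl | hij
  · exact key i j hi hj hij hab
  · exact absurd hab (H.loopless.irrefl _)
  · rw [Sym2.eq_swap]
    exact key j i hj hi hij hab.symm

/-- The graph `G` with only the edges inside `T`. -/
def restrictTo (G : SimpleGraph V) (T : Set V) : SimpleGraph V where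
  Adj a b := G.Adj a b ∧ a ∈ T ∧ b ∈ T
  symm := ⟨fun _ _ h => ⟨h.1.symm, h.2.2, h.2.1⟩⟩
  loopless := ⟨fun _ h => G.loopless.irrefl _ h.1⟩

theorem restrictTo_le (G : SimpleGraph V) (T : Set V) : restrictTo G T ≤ G := fun _ _ h => h.1

theorem restrictTo_mono (G : SimpleGraph V) {S T : Set V} (h : S ⊆ T) :
    restrictTo G S ≤ restrictTo G T := fun _ _ hab => ⟨hab.1, h hab.2.1, h hab.2.2⟩

theorem mem_of_mem_support_restrictTo {G : SimpleGraph V} {T : Set V} {x y : V}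
    (p : (restrictTo G T).Walk x y) (hx : x ∈ T) : ∀ z ∈ p.support, z ∈ T := by
  induction p with
  | nil => simpa using hx
  | cons h q ih =>
    intro z hz
    rw [Walk.support_cons, List.mem_cons] at hz
    rcases hz with rfl | hz
    · exact hx
    · exact ih h.2.2 z hz

theorem IsChordal.adj_of_reachable {G : SimpleGraph V} (hG : IsChordal G) {u x y : V} {R : Set V}
    (hR : ∀ z ∈ R, z ≠ u ∧ ¬ G.Adj u z) (hux : G.Adj u x) (huy : G.Adj u y) (hxy : x ≠ y)
    (hreach : (restrictTo G (R ∪ {x, y})).Reachable x y) : G.Adj x y := by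
  by_contra hnadj
  obtain ⟨p, hpath, hlen⟩ := hreach.exists_path_of_dist
  have hT := mem_of_mem_support_restrictTo p (Or.inr (Or.inl rfl))
  have hu : u ∉ p.support := by
    intro h
    rcases hT u h with h | h | h
    · exact (hR u h).1 rfl
    · exact hux.ne h
    · exact huy.ne h
  have hlen2 : 2 ≤ p.length := by
    by_contra hlt
    have h01 : p.length = 0 ∨ p.length = 1 := by omega
    rcases h01 with h0 | h1
    · exact hxy (Walk.eq_of_length_eq_zero h0)
    · exact hnadj (Walk.adj_of_length_eq_one h1).1
  set q : G.Walk x y := p.mapLe (restrictTo_le G _) with hq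
  have hqs : q.support = p.support := Walk.support_mapLe_eq_support _ _
  have hqe : q.edges = p.edges := Walk.edges_mapLe_eq_edges _ _
  have hql : q.length = p.length := Walk.length_mapLe _ _
  have hcyc : (Walk.cons hux (q.concat huy.symm)).IsCycle := by
    rw [Walk.cons_isCycle_iff, Walk.concat_isPath_iff, hqs, Walk.edges_concat, List.concat_eq_append,
      List.mem_append, List.mem_singleton, not_or]
    refine ⟨⟨hpath.mapLe _, hu⟩, fun h => hu ?_, fun h => ?_⟩
    · rw [← hqs]
      exact Walk.fst_mem_support_of_mem_edges _ h
    · rcases Sym2.eq_iff.1 h with h | h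
      · exact huy.ne h.1
      · exact hxy h.2
  obtain ⟨a, ha, b, hb, hab, hne⟩ := hG u _ hcyc (by
    rw [Walk.length_cons, Walk.length_concat, hql]
    omega)
  have hsupp : ∀ z, z ∈ (Walk.cons hux (q.concat huy.symm)).support → z = u ∨ z ∈ p.support := by
    intro z hz
    rw [Walk.support_cons, Walk.support_concat, hqs] at hz
    simp only [List.mem_cons, List.mem_append, List.not_mem_nil, or_false] at hz
    tauto
  rw [Walk.edges_cons, Walk.edges_concat, List.concat_eq_append, List.mem_cons, List.mem_append,
    List.mem_singleton, hqe] at hne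
  have hcase : ∀ z, z ∈ p.support → G.Adj u z → z = x ∨ z = y := by
    intro z hz huz
    rcases hT z hz with h | h | h
    · exact absurd huz (hR z h).2
    · exact Or.inl h
    · exact Or.inr h
  refine hne ?_
  rcases hsupp a ha with rfl | ha' <;> rcases hsupp b hb with rfl | hb'
  · exact absurd hab (G.loopless.irrefl _)
  · rcases hcase b hb' hab with rfl | rfl
    · exact Or.inl rfl
    · exact Or.inr (Or.inr Sym2.eq_swap)
  · rcases hcase a ha' hab.symm with rfl | rfl
    · exact Or.inl Sym2.eq_swap
    · exact Or.inr (Or.inr rfl)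
  · exact Or.inr (Or.inl (mem_edges_of_length_eq_dist p hlen ha' hb' ⟨hab, hT a ha', hT b hb'⟩))

/-- In a chordal graph, a vertex that is not adjacent to all others misses a simplicial vertex. -/
theorem IsChordal.exists_isSimplicialIn_not_adj [DecidableEq V] {G : SimpleGraph V}
    (hG : IsChordal G) (W : Finset V) : ∀ u ∈ W, (∃ w ∈ W, w ≠ u ∧ ¬ G.Adj u w) →
      ∃ z ∈ W, z ≠ u ∧ ¬ G.Adj u z ∧ IsSimplicialIn G W z := by
  classical
  induction W using Finset.strongInduction with
  | H W ih =>
    rintro u hu ⟨w, hwW, hwu, huw⟩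
    set R := W.filter (fun z => z ≠ u ∧ ¬ G.Adj u z) with hRdef
    have hR : ∀ z, z ∈ R ↔ z ∈ W ∧ z ≠ u ∧ ¬ G.Adj u z := fun z => Finset.mem_filter
    set B := R.filter ((restrictTo G (R : Set V)).Reachable w) with hBdef
    have hB : ∀ z, z ∈ B ↔ z ∈ R ∧ (restrictTo G (R : Set V)).Reachable w z :=
      fun z => Finset.mem_filter
    set S := W.filter (fun s => G.Adj u s ∧ ∃ b ∈ B, G.Adj s b) with hSdef
    have hS : ∀ s, s ∈ S ↔ s ∈ W ∧ G.Adj u s ∧ ∃ b ∈ B, G.Adj s b := fun s => Finset.mem_filter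
    have hwB : w ∈ B := (hB w).2 ⟨(hR w).2 ⟨hwW, hwu, huw⟩, Reachable.refl _⟩
    have hBR : ∀ z ∈ B, z ∈ R := fun z hz => ((hB z).1 hz).1
    have hclosed : ∀ b ∈ B, ∀ x ∈ W, G.Adj b x → x ∈ B ∪ S := by
      intro b hb x hx hbx
      have hbR := (hR b).1 (hBR b hb)
      by_cases hux : G.Adj u x
      · exact Finset.mem_union_right _ ((hS x).2 ⟨hx, hux, b, hb, hbx.symm⟩)
      · have hxu : x ≠ u := by
          rintro rfl
          exact hbR.2.2 hbx.symm
        have hxR : x ∈ R := (hR x).2 ⟨hx, hxu, hux⟩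
        have hadj : (restrictTo G (R : Set V)).Adj b x := ⟨hbx, hBR b hb, hxR⟩
        exact Finset.mem_union_left _ ((hB x).2 ⟨hxR, ((hB b).1 hb).2.trans hadj.reachable⟩)
    have hSclique : ∀ x ∈ S, ∀ y ∈ S, x ≠ y → G.Adj x y := by
      intro x hx y hy hxy
      obtain ⟨-, hux, b, hb, hxb⟩ := (hS x).1 hx
      obtain ⟨-, huy, c, hc, hyc⟩ := (hS y).1 hy
      refine hG.adj_of_reachable (R := (R : Set V)) (fun z hz => ((hR z).1 hz).2) hux huy hxy ?_
      have hbc : (restrictTo G ((R : Set V) ∪ {x, y})).Reachable b c :=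
        (((hB b).1 hb).2.symm.trans ((hB c).1 hc).2).mono
          (restrictTo_mono G Set.subset_union_left)
      have h1 : (restrictTo G ((R : Set V) ∪ {x, y})).Adj x b :=
        ⟨hxb, Or.inr (Or.inl rfl), Or.inl (hBR b hb)⟩
      have h2 : (restrictTo G ((R : Set V) ∪ {x, y})).Adj c y :=
        ⟨hyc.symm, Or.inl (hBR c hc), Or.inr (Or.inr rfl)⟩
      exact (h1.reachable.trans hbc).trans h2.reachable
    have hBSW : B ∪ S ⊆ W := by
      intro z hz
      rcases Finset.mem_union.1 hz with hz | hz
      · exact ((hR z).1 (hBR z hz)).1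
      · exact ((hS z).1 hz).1
    have huBS : u ∉ B ∪ S := by
      intro h
      rcases Finset.mem_union.1 h with h | h
      · exact ((hR u).1 (hBR u h)).2.1 rfl
      · exact G.loopless.irrefl _ ((hS u).1 h).2.1
    have hss : B ∪ S ⊂ W := Finset.ssubset_iff_subset_ne.2 ⟨hBSW, fun h => huBS (h ▸ hu)⟩
    have hex : ∃ z ∈ B, IsSimplicialIn G (B ∪ S) z := by
      by_cases h1 : ∃ s ∈ S, ∃ t ∈ B ∪ S, t ≠ s ∧ ¬ G.Adj s t
      · obtain ⟨s, hs, ht⟩ := h1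
        obtain ⟨z, hz, hzs, hsz, hsimp⟩ := ih _ hss s (Finset.mem_union_right _ hs) ht
        refine ⟨z, (Finset.mem_union.1 hz).resolve_right fun hzS => ?_, hsimp⟩
        exact hsz (hSclique s hs z hzS hzs.symm)
      · push Not at h1
        by_cases h2 : ∃ b ∈ B, ∃ t ∈ B ∪ S, t ≠ b ∧ ¬ G.Adj b t
        · obtain ⟨b, hb, ht⟩ := h2
          obtain ⟨z, hz, hzb, hbz, hsimp⟩ := ih _ hss b (Finset.mem_union_left _ hb) ht
          refine ⟨z, (Finset.mem_union.1 hz).resolve_right fun hzS => ?_, hsimp⟩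
          exact hbz (h1 z hzS b (Finset.mem_union_left _ hb) hzb.symm).symm
        · push Not at h2
          refine ⟨w, hwB, fun x hx y hy _ _ hxy => ?_⟩
          rcases Finset.mem_union.1 hx with hx | hx
          · exact h2 x hx y hy hxy.symm
          · exact h1 x hx y hy hxy.symm
    obtain ⟨z, hzB, hsimp⟩ := hex
    obtain ⟨hzW, hzu, huz⟩ := (hR z).1 (hBR z hzB)
    exact ⟨z, hzW, hzu, huz, fun x hx y hy hzx hzy hxy =>
      hsimp x (hclosed z hzB x hx hzx) y (hclosed z hzB y hy hzy) hzx hzy hxy⟩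

/-- Every nonempty set of vertices of a chordal graph has a simplicial vertex. -/
theorem IsChordal.exists_isSimplicialIn [DecidableEq V] {G : SimpleGraph V} (hG : IsChordal G)
    (W : Finset V) (hW : W.Nonempty) : ∃ z ∈ W, IsSimplicialIn G W z := by
  by_cases h : ∃ u ∈ W, ∃ w ∈ W, w ≠ u ∧ ¬ G.Adj u w
  · obtain ⟨u, hu, hw⟩ := h
    obtain ⟨z, hz, -, -, hs⟩ := hG.exists_isSimplicialIn_not_adj W u hu hw
    exact ⟨z, hz, hs⟩
  · push Not at h
    obtain ⟨z, hz⟩ := hW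
    exact ⟨z, hz, fun x hx y hy _ _ hxy => h x hx y hy hxy.symm⟩

/-- A chordal graph has a junction tree. -/
theorem IsChordal.exists_junctionTree [Fintype V] [DecidableEq V] {G : SimpleGraph V}
    (hG : IsChordal G) : ∃ J : SimpleGraph (MaxClique G), IsJunctionTree G J :=
  exists_junctionTree_of_hasRunningIntersection
    (hasRunningIntersection_of_simplicial hG.exists_isSimplicialIn Finset.univ)

end Simplicial

end QuantumGraph

theorem mainTheorem5 {V : Type*} [Fintype V] [DecidableEq V] (ι : V → Type*)
    [∀ v, Fintype (ι v)] [∀ v, DecidableEq (ι v)] (G : SimpleGraph V)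
    (hG : QuantumGraph.IsChordal G) :
    (∃ J : SimpleGraph (QuantumGraph.MaxClique G), QuantumGraph.IsJunctionTree G J) ∧
    ∀ J : SimpleGraph (QuantumGraph.MaxClique G), QuantumGraph.IsJunctionTree G J →
      ∀ ρ : QuantumGraph.GlobalOp ι, QuantumGraph.IsStrictDensity ρ →
        QuantumGraph.globalInformation J ρ =
            QuantumGraph.divergence ρ (QuantumGraph.logCandidate J ρ) + 1
              - (QuantumGraph.logCandidate J ρ).trace.re ∧
        ((QuantumGraph.logCandidate J ρ).trace = 1 →
          QuantumGraph.globalInformation J ρ =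
              QuantumGraph.divergence ρ (QuantumGraph.logCandidate J ρ) ∧
          QuantumGraph.divergence ρ (QuantumGraph.logCandidate J ρ) =
              QuantumGraph.entropy (QuantumGraph.logCandidate J ρ)
                - QuantumGraph.entropy ρ) := by
  refine ⟨hG.exists_junctionTree, fun J hJ ρ hρ => ?_⟩
  have hI := QuantumGraph.globalInformation_eq_trace J ρ
  have hD := QuantumGraph.divergence_logCandidate (J := J) hρ
  refine ⟨by linarith, fun htr => ?_⟩
  have hre : (QuantumGraph.logCandidate J ρ).trace.re = 1 := by rw [htr, Complex.one_re]
  have hS : QuantumGraph.entropy (QuantumGraph.logCandidate J ρ)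
      = -(QuantumGraph.logCandidate J ρ * QuantumGraph.logExponent J ρ).trace.re := by
    rw [QuantumGraph.entropy, QuantumGraph.matLog_logCandidate]
  rw [QuantumGraph.trace_logCandidate_mul_logExponent hJ hρ htr] at hS
  exact ⟨by linarith, by linarith⟩
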